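/- Let $n\ge 2$, let $f:\mathbb S^n\to\mathbb R$ be positive and Lipschitz continuous, and let $u:\mathbb S^n\to\mathbb R$ be continuous. Extend $f$ to $\mathbb R^{n+1}\setminus\{0\}$ homogeneously of degree $-1$ by $f(y)=|y|^{-1}f(y/|y|)$, and extend $u$ to $\mathbb R^{n+1}$ homogeneously of degree $1$ by $u(y)=|y|\,u(y/|y|)$, $u(0)=0$. All equations below are understood in the sense of distributions, and $f_\xi$ denotes the derivative of the extended $f$ in the direction $\xi$, which exists almost everywhere. (a) The extended functions satisfy $\Delta u=f$ on $\mathbb R^{n+1}$ if and only if $\Delta_{\mathbb S^n}u+nu=f$ on $\mathbb S^n$. (b) For every $x\in\mathbb S^n$ and every unit vector $\xi\perp x$, the integral $$I(x,\xi)=\int_{\mathbb R^{n+1}}\frac{-\langle\xi,y\rangle\, f_\xi(y)}{|x-y|^{n+1}}\,dy$$ converges absolutely. (c) If $\Delta u=f$ on $\mathbb R^{n+1}$, then $u$ is convex on $\mathbb R^{n+1}$ if and only if $I(x,\xi)\ge 0$ for every $x\in\mathbb S^n$ and every unit vector $\xi\perp x$. -/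

import Mathlib

open MeasureTheory Metric InnerProductSpace Laplacian
open scoped ContDiff

noncomputable section

/-- The Euclidean space `ℝ^{n+1}`. -/
abbrev EucSp (n : ℕ) : Type := EuclideanSpace ℝ (Fin (n + 1))

/-- The unit sphere `S^n` of `ℝ^{n+1}`. -/
abbrev UnitSph (n : ℕ) : Type := sphere (0 : EucSp n) 1

/-- The radial projection `y ↦ y / |y|` of a nonzero vector to the unit sphere. -/
def radialProj {n : ℕ} (y : EucSp n) (hy : y ≠ 0) : UnitSph n :=
  ⟨‖y‖⁻¹ • y, by
    have h : ‖y‖ ≠ 0 := norm_ne_zero_iff.mpr hy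
    simp [norm_smul, h]⟩

open Classical in
/-- The extension of a function on `S^n` to `ℝ^{n+1}` that is positively homogeneous of degree `k`,
namely `y ↦ |y|^k g(y/|y|)` for `y ≠ 0`. At the origin the value is set to `0`; for `k = 1` and
continuous `g` this is the continuous extension. -/
def homExt {n : ℕ} (k : ℤ) (g : UnitSph n → ℝ) (y : EucSp n) : ℝ :=
  if hy : y = 0 then 0 else ‖y‖ ^ k * g (radialProj y hy)

/-- `U` solves `Δ U = F` on `ℝ^{n+1}` in the sense of distributions. -/
def SolvesLaplace {n : ℕ} (F U : EucSp n → ℝ) : Prop :=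
  ∀ φ : EucSp n → ℝ, ContDiff ℝ ∞ φ → HasCompactSupport φ →
    ∫ y, U y * (Δ φ) y = ∫ y, F y * φ y

/-- The Laplacian of `S^n`: the value at `z` of the Laplacian of the extension of `g` that is
constant on rays. -/
def sphLaplacian {n : ℕ} (g : UnitSph n → ℝ) (z : UnitSph n) : ℝ :=
  (Δ (homExt 0 g)) (z : EucSp n)

/-- `u` solves `Δ_{S^n} u + n u = f` on `S^n` in the sense of distributions. The smooth test
functions on the sphere are the restrictions of smooth functions on `ℝ^{n+1}`, and the integrals are
taken with respect to the surface measure. -/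
def SolvesSphere {n : ℕ} (f u : UnitSph n → ℝ) : Prop :=
  ∀ ψ : EucSp n → ℝ, ContDiff ℝ ∞ ψ →
    ∫ z : UnitSph n, u z * (sphLaplacian (fun w : UnitSph n => ψ w) z + n * ψ z)
        ∂(volume : Measure (EucSp n)).toSphere
      = ∫ z : UnitSph n, f z * ψ z ∂(volume : Measure (EucSp n)).toSphere

/-- The integrand `-⟨ξ, y⟩ F_ξ(y) / |x - y|^{n+1}`, where `F_ξ` is the derivative of `F` in the
direction `ξ`. -/
def critIntegrand {n : ℕ} (F : EucSp n → ℝ) (x ξ y : EucSp n) : ℝ :=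
  -(inner ℝ ξ y) * fderiv ℝ F y ξ / ‖x - y‖ ^ (n + 1)

end

/-!
The `(-1)`-homogeneous extension of a positive Lipschitz function is `F = G⁻¹` with `G` globally
Lipschitz, `1`-homogeneous and comparable to the norm. Hence `|∂F(y)| ≤ C |y|⁻²` for the
derivative of `F`, and Rademacher's theorem, in the form of integration by parts for Lipschitz
functions, gives the distributional identity `∫ F ∂φ = -∫ ∂F φ` (`integral_inv_mul_fderiv`). All
the analysis is done with such a function `G` on a Euclidean space of dimension `N ≥ 3`.

*Absolute convergence.* For `ξ ⊥ x` the integrand is `∂_ξ F(y) ⟨x - y, ξ⟩ |x - y|^{-N}`, which is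
bounded by a multiple of `|y|⁻² |x - y|^{1-N}`. This is integrable at `0` because `N ≥ 3`, at `x`,
and at infinity (`integrable_inv_sq_mul_inv_pow`).

*Convexity.* Formally the integral is a positive multiple of `∂_ξ ∂_ξ U(x)`, because `z ↦ z
|z|^{-N}` is a multiple of the gradient of the fundamental solution. To make this precise, `U` is
mollified with the divergence of the field `|z|^{-N} z` cut off smoothly near the origin. This is
a nonnegative radial bump function, and the difference of two of its rescalings is the Laplacian
of a radial test function, on which the equation can be tested. One differentiation is moved to
`F`, and the larger scale is sent to infinity, where the linear growth of `U` makes the second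
derivatives tend to zero. The second derivative of the mollification at scale `s` is therefore the
integral above with a regularized kernel (`integral_hessRadial_eq`), and it converges to the
singular integral with error `O(s)`, uniformly away from the origin
(`exists_abs_integral_hessRadial_sub_le`).

If `U` is convex, so are its mollifications, and the singular integral is nonnegative. Conversely,
Euler's relation for the homogeneous function `U` shows that the mollified second derivatives in
the directions `x` and `η` at the point `x` are `O(s)` (`exists_abs_integral_hessRadial_self_le`),
so that nonnegativity in the directions orthogonal to `x` bounds all second derivatives at scale
`s` from below by `-O(s)`. In the limit `U` is convex on segments avoiding the origin. The
remaining segments are limits of such ones, since a two-dimensional subspace has a nonzero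
orthogonal vector (`convexOn_iff_singularHess_nonneg`).

*The equation on the sphere.* In polar coordinates `Δ = ∂_r² + n r⁻¹ ∂_r + r⁻² Δ_S`
(`sphLaplacian_eq`). Against the `1`-homogeneous function `U`, integration by parts along rays
turns `r^{n+1} (∂_r² + n r⁻¹ ∂_r) φ` into `n r^{n-1} φ`, so that `∫ U Δφ` is the integral over `r`
of `r^{n-1}` times the spherical expression tested with `z ↦ φ(r z)`. This shows that a solution
on the sphere solves the equation in space; the converse is obtained from test functions that are
products of a radial cutoff and a function constant on rays (`solvesLaplace_iff_solvesSphere`).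
-/

noncomputable section

open Filter Topology Set

/-! ### Homogeneous extensions -/

lemma homExt_of_ne {n : ℕ} (k : ℤ) (g : UnitSph n → ℝ) {y : EucSp n} (hy : y ≠ 0) :
    homExt k g y = ‖y‖ ^ k * g (radialProj y hy) := by
  simp [homExt, hy]

lemma homExt_zero {n : ℕ} (k : ℤ) (g : UnitSph n → ℝ) : homExt k g (0 : EucSp n) = 0 := by
  simp [homExt]

lemma radialProj_smul {n : ℕ} {r : ℝ} (hr : 0 < r) {y : EucSp n} (hy : y ≠ 0)
    (hry : r • y ≠ 0) : radialProj (r • y) hry = radialProj y hy := by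
  apply Subtype.ext
  simp only [radialProj, norm_smul, Real.norm_of_nonneg hr.le, smul_smul]
  congr 1
  field_simp

lemma homExt_smul {n : ℕ} (k : ℤ) (g : UnitSph n → ℝ) {r : ℝ} (hr : 0 < r) (y : EucSp n) :
    homExt k g (r • y) = r ^ k * homExt k g y := by
  by_cases hy : y = 0
  · simp [hy, homExt_zero]
  · have hry : r • y ≠ 0 := smul_ne_zero hr.ne' hy
    rw [homExt_of_ne k g hy, homExt_of_ne k g hry, radialProj_smul hr hy hry, norm_smul,
      Real.norm_of_nonneg hr.le, mul_zpow, mul_assoc]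

lemma homExt_coe {n : ℕ} (k : ℤ) (g : UnitSph n → ℝ) (z : UnitSph n) :
    homExt k g (z : EucSp n) = g z := by
  have hz : ‖(z : EucSp n)‖ = 1 := norm_eq_of_mem_sphere z
  have hz0 : (z : EucSp n) ≠ 0 := by
    intro h; simp [h] at hz
  rw [homExt_of_ne k g hz0, hz, one_zpow, one_mul]
  congr 1
  apply Subtype.ext
  simp [radialProj]

lemma homExt_neg_one_eq_inv {n : ℕ} (f : UnitSph n → ℝ) :
    homExt (-1) f = fun y => (homExt 1 (fun z => (f z)⁻¹) y)⁻¹ := by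
  ext y
  by_cases hy : y = 0
  · simp [hy, homExt_zero]
  · rw [homExt_of_ne _ _ hy, homExt_of_ne _ _ hy]
    simp [mul_comm]

lemma abs_homExt_one_le {n : ℕ} {g : UnitSph n → ℝ} {B : ℝ} (hB : ∀ z, |g z| ≤ B)
    (y : EucSp n) : |homExt 1 g y| ≤ B * ‖y‖ := by
  by_cases hy : y = 0
  · simp [hy, homExt_zero]
  · rw [homExt_of_ne _ _ hy, zpow_one, abs_mul, abs_norm, mul_comm]
    gcongr
    exact hB _

lemma continuous_radialProj {n : ℕ} :
    Continuous fun y : {y : EucSp n // y ≠ 0} => radialProj y.1 y.2 := by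
  apply Continuous.subtype_mk
  have h1 : Continuous fun y : {y : EucSp n // y ≠ 0} => ‖y.1‖ := by fun_prop
  exact (h1.inv₀ fun y => norm_ne_zero_iff.2 y.2).smul continuous_subtype_val

lemma continuous_homExt_one {n : ℕ} {u : UnitSph n → ℝ} (hu : Continuous u) :
    Continuous (homExt 1 u) := by
  obtain ⟨B, hB⟩ := (isCompact_univ (X := UnitSph n)).exists_bound_of_continuousOn
    hu.continuousOn
  have hB' : ∀ z, |u z| ≤ B := fun z => hB z (mem_univ z)
  rw [continuous_iff_continuousAt]
  intro y
  by_cases hy : y = 0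
  · subst hy
    rw [ContinuousAt, homExt_zero]
    refine squeeze_zero_norm (a := fun y : EucSp n => B * ‖y‖) (fun y => abs_homExt_one_le hB' y) ?_
    have : Continuous fun y : EucSp n => B * ‖y‖ := by fun_prop
    simpa using this.tendsto 0
  · have ho : IsOpen {y : EucSp n | y ≠ 0} := isOpen_ne
    have : ContinuousOn (homExt 1 u) {y : EucSp n | y ≠ 0} := by
      rw [continuousOn_iff_continuous_domRestrict]
      have h2 : ({y : EucSp n | y ≠ 0}).domRestrict (homExt 1 u)
          = fun y : {y : EucSp n // y ≠ 0} => ‖y.1‖ * u (radialProj y.1 y.2) := by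
        ext y
        rw [domRestrict_apply, homExt_of_ne 1 u y.2, zpow_one]
      rw [h2]
      exact (by fun_prop : Continuous fun y : {y : EucSp n // y ≠ 0} => ‖y.1‖).mul
        (hu.comp continuous_radialProj)
    exact this.continuousAt (ho.mem_nhds hy)

/-- The `1`-homogeneous extension of a Lipschitz function on the sphere is globally Lipschitz. -/
lemma lipschitzWith_homExt_one {n : ℕ} {g : UnitSph n → ℝ} {K : NNReal} (hg : LipschitzWith K g)
    {B : NNReal} (hB : ∀ z, |g z| ≤ B) : LipschitzWith (B + 2 * K) (homExt 1 g) := by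
  apply LipschitzWith.of_dist_le_mul
  intro y y'
  rw [Real.dist_eq]
  have hpush : (↑(B + 2 * K) : ℝ) = B + 2 * K := by push_cast; ring
  rw [hpush]
  by_cases hy : y = 0
  · rw [hy, homExt_zero, zero_sub, abs_neg, dist_zero_left]
    refine (abs_homExt_one_le hB y').trans ?_
    gcongr
    linarith [K.2]
  by_cases hy' : y' = 0
  · rw [hy', homExt_zero, sub_zero, dist_zero_right]
    refine (abs_homExt_one_le hB y).trans ?_
    gcongr
    linarith [K.2]
  rw [homExt_of_ne _ _ hy, homExt_of_ne _ _ hy', zpow_one, zpow_one]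
  set p := radialProj y hy
  set p' := radialProj y' hy'
  have h1 : |g p - g p'| ≤ K * dist p p' := hg.dist_le_mul p p'
  have h2 : ‖y'‖ * dist p p' ≤ 2 * dist y y' := by
    have e1 : ‖y'‖ * dist p p' = ‖(‖y'‖ - ‖y‖) • (‖y‖⁻¹ • y) + (y - y')‖ := by
      rw [Subtype.dist_eq, dist_eq_norm]
      rw [← Real.norm_of_nonneg (norm_nonneg y'), ← norm_smul]
      congr 1
      simp only [p, p', radialProj, norm_norm, smul_sub, smul_smul, sub_mul, sub_smul]
      rw [mul_inv_cancel₀ (norm_ne_zero_iff.2 hy), mul_inv_cancel₀ (norm_ne_zero_iff.2 hy')]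
      simp
    rw [e1]
    refine (norm_add_le _ _).trans ?_
    rw [norm_smul, norm_smul, norm_inv, norm_norm, inv_mul_cancel₀ (norm_ne_zero_iff.2 hy), mul_one,
      Real.norm_eq_abs]
    have := abs_norm_sub_norm_le y' y
    rw [dist_eq_norm]
    have h3 : ‖y' - y‖ = ‖y - y'‖ := norm_sub_rev _ _
    linarith
  have h3 : |‖y‖ - ‖y'‖| ≤ dist y y' := by
    rw [dist_eq_norm]; exact abs_norm_sub_norm_le y y'
  calc |‖y‖ * g p - ‖y'‖ * g p'| = |(‖y‖ - ‖y'‖) * g p + ‖y'‖ * (g p - g p')| := by ring_nf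
    _ ≤ |‖y‖ - ‖y'‖| * |g p| + ‖y'‖ * |g p - g p'| := by
        refine (abs_add_le _ _).trans ?_
        rw [abs_mul, abs_mul, abs_norm]
    _ ≤ dist y y' * B + ‖y'‖ * (K * dist p p') := by
        gcongr
        exact hB p
    _ = dist y y' * B + K * (‖y'‖ * dist p p') := by ring
    _ ≤ dist y y' * B + K * (2 * dist y y') := by gcongr
    _ = (B + 2 * K) * dist y y' := by ring

/-- The reciprocal of the `(-1)`-homogeneous extension of a positive Lipschitz function is globally
Lipschitz and comparable to the norm. -/
lemma exists_lipschitz_inv_homExt {n : ℕ} {f : UnitSph n → ℝ} (hpos : ∀ z, 0 < f z)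
    (hLip : ∃ K : NNReal, LipschitzWith K f) :
    ∃ (G : EucSp n → ℝ) (L : NNReal) (c : ℝ), 0 < c ∧ LipschitzWith L G ∧
      (∀ y, c * ‖y‖ ≤ G y) ∧ homExt (-1) f = fun y => (G y)⁻¹ := by
  obtain ⟨K, hK⟩ := hLip
  have hne : (univ : Set (UnitSph n)).Nonempty := by
    rw [← nonempty_iff_univ_nonempty]
    exact (NormedSpace.sphere_nonempty.2 zero_le_one).to_subtype
  obtain ⟨z0, -, hz0⟩ := isCompact_univ.exists_isMinOn hne hK.continuous.continuousOn
  obtain ⟨z1, -, hz1⟩ := isCompact_univ.exists_isMaxOn hne hK.continuous.continuousOn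
  have hz0 : ∀ z, f z0 ≤ f z := fun z => hz0 (mem_univ z)
  have hz1 : ∀ z, f z ≤ f z1 := fun z => hz1 (mem_univ z)
  have hm := hpos z0
  have hM := hpos z1
  have hLip' : LipschitzWith (Real.toNNReal (K / (f z0 * f z0))) (fun z => (f z)⁻¹) := by
    apply LipschitzWith.of_dist_le_mul
    intro z w
    rw [Real.coe_toNNReal _ (by positivity), Real.dist_eq,
      inv_sub_inv (hpos z).ne' (hpos w).ne', abs_div, abs_of_pos (mul_pos (hpos z) (hpos w))]
    have h1 : |f w - f z| ≤ K * dist z w := by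
      rw [abs_sub_comm]; exact hK.dist_le_mul z w
    calc |f w - f z| / (f z * f w) ≤ (K * dist z w) / (f z0 * f z0) := by
          have := hpos z
          gcongr
          · exact hz0 z
          · exact hz0 w
      _ = _ := by ring
  refine ⟨homExt 1 fun z => (f z)⁻¹, _, (f z1)⁻¹, by positivity,
    lipschitzWith_homExt_one (B := Real.toNNReal (f z0)⁻¹) hLip' ?_, ?_,
    homExt_neg_one_eq_inv f⟩
  · intro z
    rw [Real.coe_toNNReal _ (by positivity), abs_of_pos (inv_pos.2 (hpos z))]
    exact inv_anti₀ hm (hz0 z)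
  · intro y
    by_cases hy : y = 0
    · simp [hy, homExt_zero]
    · rw [homExt_of_ne _ _ hy, zpow_one, mul_comm]
      gcongr
      · exact hpos _
      · exact hz1 _

/-! ### Reciprocals of Lipschitz functions comparable to the norm -/

lemma locallyIntegrable_inv_norm_pow {E : Type*} [NormedAddCommGroup E] [NormedSpace ℝ E]
    [FiniteDimensional ℝ E] [MeasurableSpace E] [BorelSpace E] {μ : Measure E}
    [μ.IsAddHaarMeasure] {k : ℕ} (hk : k < Module.finrank ℝ E) :
    LocallyIntegrable (fun y : E => (‖y‖ ^ k)⁻¹) μ := by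
  refine locallyIntegrable_of_norm_le_rpow (C := 1) (α := k) (by lia) (by exact_mod_cast hk) ?_ ?_
  · refine .of_forall fun y => ?_
    rw [Real.rpow_neg (norm_nonneg y), Real.rpow_natCast, one_mul, norm_inv, norm_pow, norm_norm]
  · exact (by fun_prop : Measurable fun y : E => (‖y‖ ^ k)⁻¹).aestronglyMeasurable

lemma LocallyIntegrable.integrable_mul_of_hasCompactSupport {E : Type*} [TopologicalSpace E]
    [MeasurableSpace E] [OpensMeasurableSpace E] [T2Space E] {μ : Measure E}
    {F g : E → ℝ} (hF : LocallyIntegrable F μ) (hg : Continuous g) (hgs : HasCompactSupport g) :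
    Integrable (fun y => F y * g y) μ := by
  have := hF.integrable_smul_left_of_hasCompactSupport hg hgs
  refine this.congr (.of_forall fun y => ?_)
  simp [mul_comm]

section Reciprocal

variable {E : Type*} [NormedAddCommGroup E] [InnerProductSpace ℝ E] [FiniteDimensional ℝ E]
  [MeasurableSpace E] [BorelSpace E] {G : E → ℝ} {L : NNReal} {c : ℝ}

omit [InnerProductSpace ℝ E] [FiniteDimensional ℝ E] [MeasurableSpace E] [BorelSpace E] in
lemma pos_of_mul_norm_le (hc : 0 < c) (hlow : ∀ y, c * ‖y‖ ≤ G y) {y : E} (hy : y ≠ 0) :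
    0 < G y :=
  (mul_pos hc (norm_pos_iff.2 hy)).trans_le (hlow y)

omit [FiniteDimensional ℝ E] [MeasurableSpace E] [BorelSpace E] in
lemma fderiv_inv_apply {H : E → ℝ} {y : E} (hy : H y ≠ 0) (hd : DifferentiableAt ℝ H y) (v : E) :
    fderiv ℝ (fun z => (H z)⁻¹) y v = -(H y ^ 2)⁻¹ * fderiv ℝ H y v := by
  have := (hasDerivAt_inv hy).comp_hasFDerivAt y hd.hasFDerivAt
  have h2 : HasFDerivAt (fun z => (H z)⁻¹) (-(H y ^ 2)⁻¹ • fderiv ℝ H y) y := this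
  rw [h2.fderiv]
  simp

omit [FiniteDimensional ℝ E] [MeasurableSpace E] [BorelSpace E] in
lemma abs_fderiv_inv_le (hG : LipschitzWith L G) (hc : 0 < c) (hlow : ∀ y, c * ‖y‖ ≤ G y)
    {y : E} (hy : y ≠ 0) (v : E) :
    |fderiv ℝ (fun z => (G z)⁻¹) y v| ≤ L / c ^ 2 * ‖v‖ * (‖y‖ ^ 2)⁻¹ := by
  have hGy := pos_of_mul_norm_le hc hlow hy
  have hny := norm_pos_iff.2 hy
  by_cases hd : DifferentiableAt ℝ G y
  · rw [fderiv_inv_apply hGy.ne' hd, abs_mul, abs_neg, abs_of_pos (by positivity)]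
    have h1 : |fderiv ℝ G y v| ≤ L * ‖v‖ :=
      ((fderiv ℝ G y).le_opNorm v).trans (by gcongr; exact norm_fderiv_le_of_lipschitz ℝ hG)
    calc (G y ^ 2)⁻¹ * |fderiv ℝ G y v| ≤ ((c * ‖y‖) ^ 2)⁻¹ * (L * ‖v‖) := by
          gcongr
          exact hlow y
      _ = _ := by
          field_simp
  · have : ¬ DifferentiableAt ℝ (fun z => (G z)⁻¹) y := by
      intro h
      apply hd
      have := h.inv (inv_ne_zero hGy.ne')
      simpa only [Pi.inv_def, inv_inv] using this
    rw [fderiv_zero_of_not_differentiableAt this]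
    simp
    positivity

omit [FiniteDimensional ℝ E] [MeasurableSpace E] [BorelSpace E] [InnerProductSpace ℝ E] in
lemma inv_le_of_mul_norm_le (hc : 0 < c) (hlow : ∀ y, c * ‖y‖ ≤ G y) {y : E} (hy : y ≠ 0) :
    |(G y)⁻¹| ≤ c⁻¹ * ‖y‖⁻¹ := by
  have hGy := pos_of_mul_norm_le hc hlow hy
  have hny := norm_pos_iff.2 hy
  rw [abs_of_pos (inv_pos.2 hGy), ← mul_inv]
  exact inv_anti₀ (by positivity) (hlow y)

lemma locallyIntegrable_inv (hG : LipschitzWith L G) (hc : 0 < c) (hlow : ∀ y, c * ‖y‖ ≤ G y)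
    (hd : 3 ≤ Module.finrank ℝ E) : LocallyIntegrable (fun y => (G y)⁻¹) (volume : Measure E) := by
  have h := (locallyIntegrable_inv_norm_pow (μ := (volume : Measure E)) (k := 1)
    (by lia)).smul c⁻¹
  refine h.mono (hG.continuous.measurable.inv.aestronglyMeasurable) ?_
  have : Nontrivial E := Module.nontrivial_of_finrank_pos (R := ℝ) (by lia)
  filter_upwards [Measure.ae_ne volume (0 : E)] with y hy
  refine (inv_le_of_mul_norm_le hc hlow hy).trans (le_of_eq ?_)
  have hny := norm_pos_iff.2 hy
  simp [abs_of_pos hc]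

/-- Integration by parts for the reciprocal `G⁻¹` of a Lipschitz function comparable to the norm.
The singularity at the origin is removed by passing to the limit in the Lipschitz functions
`(max G δ)⁻¹`. -/
lemma integral_inv_mul_fderiv (hG : LipschitzWith L G) (hc : 0 < c) (hlow : ∀ y, c * ‖y‖ ≤ G y)
    (hd : 3 ≤ Module.finrank ℝ E) {g : E → ℝ} (hg : ContDiff ℝ 1 g) (hgs : HasCompactSupport g)
    (v : E) :
    ∫ y, (G y)⁻¹ * fderiv ℝ g y v = -∫ y, fderiv ℝ (fun z => (G z)⁻¹) y v * g y := by
  have : Nontrivial E := Module.nontrivial_of_finrank_pos (R := ℝ) (by lia)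
  set δ : ℕ → ℝ := fun k => 1 / ((k : ℝ) + 1) with hδ
  have hδpos : ∀ k, 0 < δ k := fun k => by positivity
  have hδlim : Tendsto δ atTop (𝓝 0) := tendsto_one_div_add_atTop_nhds_zero_nat
  set H : ℕ → E → ℝ := fun k y => max (G y) (δ k) with hH
  have hHlip : ∀ k, LipschitzWith L (H k) := fun k => hG.max_const (δ k)
  have hHpos : ∀ k y, δ k ≤ H k y := fun k y => le_max_right _ _
  have hHG : ∀ k y, G y ≤ H k y := fun k y => le_max_left _ _
  have hHinv : ∀ k, LipschitzWith (Real.toNNReal (L / δ k ^ 2)) (fun y => (H k y)⁻¹) := by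
    intro k
    apply LipschitzWith.of_dist_le_mul
    intro z w
    have hz := (hδpos k).trans_le (hHpos k z)
    have hw := (hδpos k).trans_le (hHpos k w)
    rw [Real.coe_toNNReal _ (by have := hδpos k; positivity), Real.dist_eq,
      inv_sub_inv hz.ne' hw.ne', abs_div, abs_of_pos (mul_pos hz hw)]
    have h1 : |H k w - H k z| ≤ L * dist z w := by
      rw [abs_sub_comm]; exact (hHlip k).dist_le_mul z w
    have := hδpos k
    calc |H k w - H k z| / (H k z * H k w) ≤ (L * dist z w) / (δ k * δ k) := by
          gcongr
          · exact hHpos k z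
          · exact hHpos k w
      _ = _ := by ring
  obtain ⟨D, hD⟩ := ContDiff.lipschitzWith_of_hasCompactSupport hgs hg one_ne_zero
  have hgd : Differentiable ℝ g := hg.differentiable one_ne_zero
  have key : ∀ k, ∫ y, lineDeriv ℝ (fun y => (H k y)⁻¹) y v * g y
      = -∫ y, (H k y)⁻¹ * fderiv ℝ g y v := by
    intro k
    rw [LipschitzWith.integral_lineDeriv_mul_eq (hHinv k) hD hgs, ← integral_neg]
    congr 1
    ext y
    rw [hgd.differentiableAt.lineDeriv_eq_fderiv, map_neg]
    ring
  have hdiffH : ∀ᵐ y ∂(volume : Measure E), ∀ k, DifferentiableAt ℝ (H k) y :=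
    ae_all_iff.2 fun k => (hHlip k).ae_differentiableAt
  have hev : ∀ y : E, y ≠ 0 → ∀ᶠ k in atTop, H k =ᶠ[𝓝 y] G := by
    intro y hy
    have hGy := pos_of_mul_norm_le hc hlow hy
    filter_upwards [hδlim.eventually_lt_const hGy] with k hk
    filter_upwards [hG.continuous.continuousAt.eventually (lt_mem_nhds hk)] with z hz
    exact max_eq_left hz.le
  have lim1 : Tendsto (fun k => ∫ y, lineDeriv ℝ (fun y => (H k y)⁻¹) y v * g y) atTop
      (𝓝 (∫ y, fderiv ℝ (fun z => (G z)⁻¹) y v * g y)) := by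
    refine tendsto_integral_of_dominated_convergence
      (fun y => (L / c ^ 2 * ‖v‖) * ((‖y‖ ^ 2)⁻¹ * |g y|)) ?_ ?_ ?_ ?_
    · intro k
      exact ((measurable_lineDeriv (hHinv k).continuous).aestronglyMeasurable).mul
        hg.continuous.aestronglyMeasurable
    · refine Integrable.const_mul ?_ _
      exact LocallyIntegrable.integrable_mul_of_hasCompactSupport
        (locallyIntegrable_inv_norm_pow (by lia)) hg.continuous.abs hgs.norm
    · intro k
      filter_upwards [hdiffH, Measure.ae_ne volume (0 : E)] with y hy hy0
      have hHy := (hδpos k).trans_le (hHpos k y)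
      have hdi : DifferentiableAt ℝ (fun y => (H k y)⁻¹) y := (hy k).inv hHy.ne'
      rw [hdi.lineDeriv_eq_fderiv, norm_mul, Real.norm_eq_abs, Real.norm_eq_abs, ← mul_assoc]
      gcongr
      exact abs_fderiv_inv_le (hHlip k) hc (fun z => (hlow z).trans (hHG k z)) hy0 v
    · filter_upwards [hdiffH, Measure.ae_ne volume (0 : E)] with y hy hy0
      refine tendsto_const_nhds.congr' ?_
      filter_upwards [hev y hy0] with k hk
      have hHy := (hδpos k).trans_le (hHpos k y)
      have hdi : DifferentiableAt ℝ (fun y => (H k y)⁻¹) y := (hy k).inv hHy.ne'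
      rw [hdi.lineDeriv_eq_fderiv]
      congr 2
      apply Filter.EventuallyEq.fderiv_eq
      filter_upwards [hk] with z hz
      rw [hz]
  have lim2 : Tendsto (fun k => -∫ y, (H k y)⁻¹ * fderiv ℝ g y v) atTop
      (𝓝 (-∫ y, (G y)⁻¹ * fderiv ℝ g y v)) := by
    refine Tendsto.neg (tendsto_integral_of_dominated_convergence
      (fun y => c⁻¹ * ((‖y‖ ^ 1)⁻¹ * |fderiv ℝ g y v|)) ?_ ?_ ?_ ?_)
    · intro k
      exact ((hHlip k).continuous.measurable.inv.aestronglyMeasurable).mul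
        ((hg.continuous_fderiv one_ne_zero).clm_apply continuous_const).aestronglyMeasurable
    · refine Integrable.const_mul ?_ _
      exact LocallyIntegrable.integrable_mul_of_hasCompactSupport
        (locallyIntegrable_inv_norm_pow (by lia))
        ((hg.continuous_fderiv one_ne_zero).clm_apply continuous_const).abs
        (hgs.fderiv_apply ℝ v).norm
    · intro k
      filter_upwards [Measure.ae_ne volume (0 : E)] with y hy0
      rw [norm_mul, Real.norm_eq_abs, Real.norm_eq_abs, ← mul_assoc, pow_one]
      gcongr
      exact inv_le_of_mul_norm_le hc (fun z => (hlow z).trans (hHG k z)) hy0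
    · filter_upwards [Measure.ae_ne volume (0 : E)] with y hy0
      refine tendsto_const_nhds.congr' ?_
      filter_upwards [hev y hy0] with k hk
      rw [hk.eq_of_nhds]
  have := tendsto_nhds_unique (lim1.congr key) lim2
  linarith

end Reciprocal

/-! ### Second derivatives along lines, radial functions and convolutions -/

section Lines

variable {E : Type*} [NormedAddCommGroup E] [InnerProductSpace ℝ E]

lemma hasDerivAt_comp_line {h : E → ℝ} {x v : E} {t : ℝ}
    (hd : DifferentiableAt ℝ h (x + t • v)) :
    HasDerivAt (fun s : ℝ => h (x + s • v)) (fderiv ℝ h (x + t • v) v) t := by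
  have hl : HasDerivAt (fun s : ℝ => x + s • v) v t := by
    simpa using ((hasDerivAt_id t).smul_const v).const_add x
  exact hd.hasFDerivAt.comp_hasDerivAt t hl

/-- The Laplacian is the sum of the second derivatives along the lines in the directions of an
orthonormal basis. -/
lemma laplacian_eq_sum_of_hasDerivAt [FiniteDimensional ℝ E] {ι : Type*} [Fintype ι]
    (b : OrthonormalBasis ι ℝ E) {h : E → ℝ} {x : E} (hh : ContDiffAt ℝ 2 h x) {D : ι → ℝ → ℝ}
    {c : ι → ℝ} (hD : ∀ i, ∀ᶠ t in 𝓝 (0 : ℝ), HasDerivAt (fun s : ℝ => h (x + s • b i)) (D i t) t)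
    (hc : ∀ i, HasDerivAt (D i) (c i) 0) : (Δ h) x = ∑ i, c i := by
  rw [laplacian_eq_iteratedFDeriv_orthonormalBasis h b]
  refine Finset.sum_congr rfl fun i _ => ?_
  rw [iteratedFDeriv_two_apply]
  simp only [Matrix.cons_val_zero, Matrix.cons_val_one]
  have hcont : ContinuousAt (fun s : ℝ => x + s • b i) 0 := by fun_prop
  have hdiff : ∀ᶠ t in 𝓝 (0 : ℝ), DifferentiableAt ℝ h (x + t • b i) := by
    have : ∀ᶠ y in 𝓝 x, DifferentiableAt ℝ h y := by
      filter_upwards [hh.eventually (by simp)] with y hy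
      exact hy.differentiableAt two_ne_zero
    exact hcont.eventually (by simpa using this)
  have hd2 : DifferentiableAt ℝ (fderiv ℝ h) x :=
    (hh.fderiv_right (m := 1) (by norm_num)).differentiableAt one_ne_zero
  have hd3 : DifferentiableAt ℝ (fun y => fderiv ℝ h y (b i)) (x + (0 : ℝ) • b i) := by
    rw [zero_smul, add_zero]
    exact hd2.clm_apply (differentiableAt_const _)
  have h1 := hasDerivAt_comp_line hd3
  rw [zero_smul, add_zero, fderiv_clm_apply hd2 (differentiableAt_const _)] at h1
  have h2 : HasDerivAt (D i) (fderiv ℝ (fderiv ℝ h) x (b i) (b i)) 0 := by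
    have h3 : (fun s : ℝ => fderiv ℝ h (x + s • b i) (b i)) =ᶠ[𝓝 0] D i := by
      filter_upwards [hdiff, hD i] with t ht ht'
      exact (hasDerivAt_comp_line ht).unique ht'
    have := h1.congr_of_eventuallyEq h3.symm
    simpa using this
  exact h2.unique (hc i)

/-- The Laplacian of a radial function multiplied by an affine function. -/
lemma laplacian_affine_mul_radial [FiniteDimensional ℝ E] {M : ℝ → ℝ} (hM : ContDiff ℝ 2 M)
    (a : ℝ) (η x y : E) :
    (Δ fun y => (a + inner ℝ η (x - y)) * M (‖x - y‖ ^ 2)) y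
      = (a + inner ℝ η (x - y)) * (4 * ‖x - y‖ ^ 2 * deriv (deriv M) (‖x - y‖ ^ 2)
          + 2 * Module.finrank ℝ E * deriv M (‖x - y‖ ^ 2))
        + 4 * inner ℝ η (x - y) * deriv M (‖x - y‖ ^ 2) := by
  set b := stdOrthonormalBasis ℝ E
  set z := x - y with hz
  have hdM : ∀ ρ, HasDerivAt M (deriv M ρ) ρ := fun ρ =>
    (hM.differentiable two_ne_zero).differentiableAt.hasDerivAt
  have hM1 : ContDiff ℝ 1 (deriv M) := (contDiff_succ_iff_deriv (n := 1).1 hM).2.2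
  have hdM1 : ∀ ρ, HasDerivAt (deriv M) (deriv (deriv M) ρ) ρ := fun ρ =>
    (hM1.differentiable one_ne_zero).differentiableAt.hasDerivAt
  have hsmooth : ContDiff ℝ 2 fun y => (a + inner ℝ η (x - y)) * M (‖x - y‖ ^ 2) := by
    refine ContDiff.mul (contDiff_const.add (contDiff_const.inner ℝ
      (contDiff_const.sub contDiff_id))) (hM.comp ?_)
    exact (contDiff_const.sub contDiff_id).norm_sq ℝ
  have hexp : ∀ (e : E), ‖e‖ = 1 → ∀ s : ℝ,
      ‖x - (y + s • e)‖ ^ 2 = ‖z‖ ^ 2 - 2 * s * inner ℝ z e + s ^ 2 := by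
    intro e he s
    rw [show x - (y + s • e) = z - s • e by rw [hz]; abel, norm_sub_sq_real, inner_smul_right,
      norm_smul, he, Real.norm_eq_abs, mul_one, sq_abs]
    ring
  have hexp2 : ∀ (e : E) (s : ℝ), inner ℝ η (x - (y + s • e)) = inner ℝ η z - s * inner ℝ η e := by
    intro e s
    rw [show x - (y + s • e) = z - s • e by rw [hz]; abel, inner_sub_right, inner_smul_right]
  have hρ : ∀ (e : E) (t : ℝ), HasDerivAt
      (fun s : ℝ => ‖z‖ ^ 2 - 2 * s * inner ℝ z e + s ^ 2) (-2 * inner ℝ z e + 2 * t) t := by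
    intro e t
    have h1 : HasDerivAt (fun s : ℝ => 2 * s * inner ℝ z e) (2 * inner ℝ z e) t := by
      simpa using ((hasDerivAt_id t).const_mul 2).mul_const (inner ℝ z e)
    have h2 : HasDerivAt (fun s : ℝ => s ^ 2) (2 * t) t := by
      simpa using hasDerivAt_pow 2 t
    have := ((hasDerivAt_const t (‖z‖ ^ 2)).sub h1).add h2
    refine this.congr_deriv (by ring)
  have hlin : ∀ (e : E) (t : ℝ), HasDerivAt
      (fun s : ℝ => a + (inner ℝ η z - s * inner ℝ η e)) (-inner ℝ η e) t := by
    intro e t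
    have := (((hasDerivAt_id t).mul_const (inner ℝ η e)).const_sub (inner ℝ η z)).const_add a
    simpa using this
  have hdM' : ∀ (e : E) (t : ℝ), HasDerivAt
      (fun s : ℝ => M (‖z‖ ^ 2 - 2 * s * inner ℝ z e + s ^ 2))
      (deriv M (‖z‖ ^ 2 - 2 * t * inner ℝ z e + t ^ 2) * (-2 * inner ℝ z e + 2 * t)) t :=
    fun e t => (hdM _).comp t (hρ e t)
  have hdM1' : ∀ (e : E) (t : ℝ), HasDerivAt
      (fun s : ℝ => deriv M (‖z‖ ^ 2 - 2 * s * inner ℝ z e + s ^ 2))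
      (deriv (deriv M) (‖z‖ ^ 2 - 2 * t * inner ℝ z e + t ^ 2) * (-2 * inner ℝ z e + 2 * t)) t :=
    fun e t => (hdM1 _).comp t (hρ e t)
  rw [laplacian_eq_sum_of_hasDerivAt b hsmooth.contDiffAt
    (D := fun i t => -inner ℝ η (b i) * M (‖z‖ ^ 2 - 2 * t * inner ℝ z (b i) + t ^ 2)
      + (a + (inner ℝ η z - t * inner ℝ η (b i))) *
        (deriv M (‖z‖ ^ 2 - 2 * t * inner ℝ z (b i) + t ^ 2) * (-2 * inner ℝ z (b i) + 2 * t)))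
    (c := fun i => 4 * deriv M (‖z‖ ^ 2) * (inner ℝ η (b i) * inner ℝ (b i) z)
      + (a + inner ℝ η z) * (4 * deriv (deriv M) (‖z‖ ^ 2) * (inner ℝ z (b i) * inner ℝ (b i) z))
      + (a + inner ℝ η z) * (2 * deriv M (‖z‖ ^ 2)))]
  · rw [Finset.sum_add_distrib, Finset.sum_add_distrib, ← Finset.mul_sum, ← Finset.mul_sum,
      ← Finset.mul_sum, b.sum_inner_mul_inner, b.sum_inner_mul_inner, real_inner_self_eq_norm_sq]
    simp
    ring
  · intro i
    refine .of_forall fun t => ?_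
    have := (hlin (b i) t).mul (hdM' (b i) t)
    refine this.congr_of_eventuallyEq (.of_forall fun s => ?_)
    simp only [Pi.mul_apply]
    rw [hexp _ (b.norm_eq_one i), hexp2]
  · intro i
    have hid : HasDerivAt (fun t : ℝ => -2 * inner ℝ z (b i) + 2 * t) 2 0 := by
      simpa using ((hasDerivAt_id (0 : ℝ)).const_mul 2).const_add (-2 * inner ℝ z (b i))
    have := ((hdM' (b i) 0).const_mul (-inner ℝ η (b i))).add
      ((hlin (b i) 0).mul ((hdM1' (b i) 0).mul hid))
    refine this.congr_deriv ?_
    simp only [mul_zero, zero_mul, sub_zero, add_zero, zero_pow, ne_eq, OfNat.ofNat_ne_zero,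
      not_false_eq_true, Pi.mul_apply]
    rw [real_inner_comm z (b i)]
    ring

/-- The second derivative of `z ↦ κ(|z|²)` at `z` in the directions `ξ`, `η`. -/
def hessRadial (κ : ℝ → ℝ) (ξ η z : E) : ℝ :=
  4 * deriv (deriv κ) (‖z‖ ^ 2) * (inner ℝ z ξ * inner ℝ z η)
    + 2 * deriv κ (‖z‖ ^ 2) * inner ℝ ξ η

lemma hasFDerivAt_radial {κ : ℝ → ℝ} (hκ : Differentiable ℝ κ) (z : E) :
    HasFDerivAt (fun z : E => κ (‖z‖ ^ 2)) ((2 * deriv κ (‖z‖ ^ 2)) • innerSL ℝ z) z := by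
  have h1 : HasFDerivAt (fun z : E => ‖z‖ ^ 2) (2 • innerSL ℝ z) z :=
    (hasStrictFDerivAt_norm_sq z).hasFDerivAt
  have := (hκ.differentiableAt (x := ‖z‖ ^ 2)).hasDerivAt.comp_hasFDerivAt z h1
  refine this.congr_fderiv ?_
  ext v
  simp
  ring

lemma fderiv_radial_apply {κ : ℝ → ℝ} (hκ : Differentiable ℝ κ) (z ξ : E) :
    fderiv ℝ (fun z : E => κ (‖z‖ ^ 2)) z ξ = 2 * deriv κ (‖z‖ ^ 2) * inner ℝ z ξ := by
  rw [(hasFDerivAt_radial hκ z).fderiv]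
  simp

lemma fderiv_fderiv_radial_apply {κ : ℝ → ℝ} (hκ : ContDiff ℝ 2 κ) (z ξ η : E) :
    fderiv ℝ (fun z : E => 2 * deriv κ (‖z‖ ^ 2) * inner ℝ z ξ) z η = hessRadial κ ξ η z := by
  have hM1 : ContDiff ℝ 1 (deriv κ) := (contDiff_succ_iff_deriv (n := 1).1 hκ).2.2
  have h1 := (hasFDerivAt_radial (hM1.differentiable one_ne_zero) z).const_mul 2
  have h2 : HasFDerivAt (fun z : E => inner ℝ z ξ) (innerSL ℝ ξ) z := by
    have := (innerSL ℝ ξ).hasFDerivAt (x := z)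
    refine this.congr_of_eventuallyEq (.of_forall fun w => ?_)
    simp [real_inner_comm]
  rw [(h1.fun_mul h2).fderiv]
  simp [hessRadial]
  ring

lemma contDiff_radial {κ : ℝ → ℝ} {m : ℕ∞} (hκ : ContDiff ℝ m κ) :
    ContDiff ℝ m fun z : E => κ (‖z‖ ^ 2) :=
  hκ.comp (contDiff_id.norm_sq ℝ)

lemma hasCompactSupport_radial [FiniteDimensional ℝ E] {κ : ℝ → ℝ} {B : ℝ}
    (hB : ∀ ρ, B ≤ ρ → κ ρ = 0) :
    HasCompactSupport fun z : E => κ (‖z‖ ^ 2) := by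
  refine HasCompactSupport.of_support_subset_isCompact (isCompact_closedBall (0 : E) (max B 1)) ?_
  intro z hz
  rw [Function.mem_support] at hz
  rw [mem_closedBall_zero_iff]
  by_contra hcon
  push Not at hcon
  apply hz
  apply hB
  have h1 := (le_max_right B 1).trans_lt hcon
  have h2 := (le_max_left B 1).trans_lt hcon
  nlinarith

/-- Differentiation under the integral sign of a convolution with a test function. -/
lemma hasDerivAt_integral_mul_comp_sub [FiniteDimensional ℝ E] [MeasurableSpace E] [BorelSpace E]
    {A g : E → ℝ}
    (hA : LocallyIntegrable A (volume : Measure E)) (hg : ContDiff ℝ 1 g)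
    (hgs : HasCompactSupport g) (x ξ : E) (t : ℝ) :
    HasDerivAt (fun s : ℝ => ∫ y, A y * g (x + s • ξ - y))
      (∫ y, A y * fderiv ℝ g (x + t • ξ - y) ξ) t := by
  have h1 := hgs.hasFDerivAt_convolution_right (ContinuousLinearMap.mul ℝ ℝ) hA hg (x + t • ξ)
  have hl : HasDerivAt (fun s : ℝ => x + s • ξ) ξ t := by
    simpa using ((hasDerivAt_id t).smul_const ξ).const_add x
  have h2 := h1.comp_hasDerivAt t hl
  rw [convolution_precompR_apply _ hA (hgs.fderiv ℝ) (hg.continuous_fderiv one_ne_zero)] at h2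
  exact h2

lemma integrable_mul_comp_sub [FiniteDimensional ℝ E] [MeasurableSpace E] [BorelSpace E]
    {A g : E → ℝ} (hA : LocallyIntegrable A (volume : Measure E)) (hg : Continuous g)
    (hgs : HasCompactSupport g) (x : E) : Integrable fun y => A y * g (x - y) :=
  LocallyIntegrable.integrable_mul_of_hasCompactSupport hA (by fun_prop)
    (hgs.comp_homeomorph (Homeomorph.subLeft x))

end Lines

/-! ### Radial mollifiers obtained by smoothing the Newtonian kernel -/

/-- The function `ρ ↦ ρ^{-N/2}`, smoothly cut off to `0` for `ρ ≤ 1`. The field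
`z ↦ newtonCutoff N (|z|²) z` agrees, up to a factor, with the gradient of the fundamental solution
of the Laplacian of `ℝ^N` away from the origin. -/
def newtonCutoff (N : ℕ) (ρ : ℝ) : ℝ := ρ ^ (-(N : ℝ) / 2) * Real.smoothTransition (ρ - 1)

/-- The divergence of the field `z ↦ newtonCutoff N (|z|²) z` of `ℝ^N`, as a function of `|z|²`. -/
def mollProfile (N : ℕ) (ρ : ℝ) : ℝ := 2 * ρ * deriv (newtonCutoff N) ρ + N * newtonCutoff N ρ

/-- The profile of `z ↦ s^{-N} k(z/s)`, where `k(z) = h(|z|²)`. -/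
def scaleProfile (N : ℕ) (h : ℝ → ℝ) (s ρ : ℝ) : ℝ := (s ^ N)⁻¹ * h (ρ / s ^ 2)

lemma newtonCutoff_of_le_one (N : ℕ) {ρ : ℝ} (hρ : ρ ≤ 1) : newtonCutoff N ρ = 0 := by
  simp [newtonCutoff, Real.smoothTransition.zero_of_nonpos (sub_nonpos.2 hρ)]

lemma contDiff_newtonCutoff (N : ℕ) : ContDiff ℝ ∞ (newtonCutoff N) := by
  rw [contDiff_iff_contDiffAt]
  intro ρ
  by_cases hρ : ρ < 1
  · have : newtonCutoff N =ᶠ[𝓝 ρ] fun _ => 0 := by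
      filter_upwards [gt_mem_nhds hρ] with σ hσ
      exact newtonCutoff_of_le_one N hσ.le
    exact contDiffAt_const.congr_of_eventuallyEq this
  · have hρ0 : ρ ≠ 0 := by linarith
    refine (Real.contDiffAt_rpow_const_of_ne hρ0).mul ?_
    exact (Real.smoothTransition.contDiff.comp (contDiff_id.sub contDiff_const)).contDiffAt

lemma newtonCutoff_sq_nonneg (N : ℕ) (r : ℝ) : 0 ≤ newtonCutoff N (r ^ 2) :=
  mul_nonneg (Real.rpow_nonneg (sq_nonneg r) _) (Real.smoothTransition.nonneg _)

lemma sq_rpow_neg_half (N : ℕ) {r : ℝ} (hr : 0 ≤ r) : (r ^ 2) ^ (-(N : ℝ) / 2) = (r ^ N)⁻¹ := by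
  rw [← Real.rpow_natCast r 2, ← Real.rpow_mul hr, ← Real.rpow_natCast r N, ← Real.rpow_neg hr]
  congr 1
  push_cast
  ring

lemma newtonCutoff_sq_le (N : ℕ) {r : ℝ} (hr : 0 ≤ r) : newtonCutoff N (r ^ 2) ≤ (r ^ N)⁻¹ := by
  rw [newtonCutoff, sq_rpow_neg_half N hr]
  exact mul_le_of_le_one_right (by positivity) (Real.smoothTransition.le_one _)

lemma newtonCutoff_sq_eq (N : ℕ) {r : ℝ} (hr : 0 ≤ r) (h : 2 ≤ r ^ 2) :
    newtonCutoff N (r ^ 2) = (r ^ N)⁻¹ := by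
  rw [newtonCutoff, sq_rpow_neg_half N hr, Real.smoothTransition.one_of_one_le (by linarith),
    mul_one]

lemma contDiff_mollProfile (N : ℕ) : ContDiff ℝ ∞ (mollProfile N) := by
  have h1 := contDiff_newtonCutoff N
  have h2 : ContDiff ℝ ∞ (deriv (newtonCutoff N)) := (contDiff_infty_iff_deriv.1 h1).2
  exact ((contDiff_const.mul contDiff_id).mul h2).add (contDiff_const.mul h1)

/-- The field `|z|^{-N} z` is divergence free, so that only the derivative of the cutoff contributes
to the mollifier. -/
lemma mollProfile_eq (N : ℕ) {ρ : ℝ} (hρ : 0 < ρ) : mollProfile N ρ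
    = 2 * ρ * ρ ^ (-(N : ℝ) / 2) * deriv Real.smoothTransition (ρ - 1) := by
  have h1 : HasDerivAt (fun ρ : ℝ => ρ ^ (-(N : ℝ) / 2))
      ((-(N : ℝ) / 2) * ρ ^ (-(N : ℝ) / 2 - 1)) ρ := Real.hasDerivAt_rpow_const (.inl hρ.ne')
  have h2 : HasDerivAt (fun ρ : ℝ => Real.smoothTransition (ρ - 1))
      (deriv Real.smoothTransition (ρ - 1)) ρ := by
    have := ((Real.smoothTransition.contDiff (n := 1)).differentiable
      (by norm_num)).differentiableAt (x := ρ - 1) |>.hasDerivAt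
    exact this.comp_sub_const ρ 1
  have h3 : deriv (newtonCutoff N) ρ = _ := (h1.mul h2).deriv
  rw [mollProfile, h3, newtonCutoff, Real.rpow_sub hρ, Real.rpow_one]
  field_simp
  ring

lemma mollProfile_of_lt_one (N : ℕ) {ρ : ℝ} (hρ : ρ < 1) : mollProfile N ρ = 0 := by
  have : newtonCutoff N =ᶠ[𝓝 ρ] fun _ => 0 := by
    filter_upwards [gt_mem_nhds hρ] with σ hσ
    exact newtonCutoff_of_le_one N hσ.le
  rw [mollProfile, this.deriv_eq, this.eq_of_nhds]
  simp

lemma mollProfile_nonneg (N : ℕ) (ρ : ℝ) : 0 ≤ mollProfile N ρ := by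
  by_cases hρ : ρ < 1
  · rw [mollProfile_of_lt_one N hρ]
  · have hρ : 0 < ρ := by linarith
    rw [mollProfile_eq N hρ]
    have := Real.smoothTransition.monotone.deriv_nonneg (x := ρ - 1)
    positivity

lemma mollProfile_of_three_le (N : ℕ) {ρ : ℝ} (hρ : 3 ≤ ρ) : mollProfile N ρ = 0 := by
  rw [mollProfile_eq N (by linarith)]
  have : Real.smoothTransition =ᶠ[𝓝 (ρ - 1)] fun _ => 1 := by
    filter_upwards [lt_mem_nhds (show 1 < ρ - 1 by linarith)] with σ hσ
    exact Real.smoothTransition.one_of_one_le hσ.le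
  rw [this.deriv_eq]
  simp

lemma exists_mollProfile_ne_zero (N : ℕ) : ∃ r : ℝ, 0 < r ∧ mollProfile N (r ^ 2) ≠ 0 := by
  -- The smooth transition from `0` to `1` has a nonzero derivative somewhere on `(0, 1)`.
  obtain ⟨σ, hσ, h⟩ := exists_deriv_eq_slope Real.smoothTransition zero_lt_one
    Real.smoothTransition.continuous.continuousOn
    ((Real.smoothTransition.contDiff (n := 1)).differentiable (by norm_num)).differentiableOn
  have hσ1 : 0 < σ + 1 := by linarith [hσ.1]
  refine ⟨√(σ + 1), Real.sqrt_pos.2 hσ1, ?_⟩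
  rw [Real.sq_sqrt hσ1.le, mollProfile_eq N hσ1, add_sub_cancel_right, h,
    Real.smoothTransition.one, Real.smoothTransition.zero]
  have := Real.rpow_pos_of_pos hσ1 (-(N : ℝ) / 2)
  have : 0 < 2 * (σ + 1) * (σ + 1) ^ (-(N : ℝ) / 2) * ((1 - 0) / (1 - 0)) := by
    norm_num; positivity
  exact this.ne'

lemma contDiff_scaleProfile (N : ℕ) {h : ℝ → ℝ} (hh : ContDiff ℝ ∞ h) (s : ℝ) :
    ContDiff ℝ ∞ (scaleProfile N h s) :=
  contDiff_const.mul (hh.comp (contDiff_id.div_const _))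

lemma deriv_scaleProfile (N : ℕ) {h : ℝ → ℝ} (hh : ContDiff ℝ ∞ h) (s ρ : ℝ) :
    deriv (scaleProfile N h s) ρ = (s ^ N)⁻¹ * (deriv h (ρ / s ^ 2) / s ^ 2) := by
  have h1 : HasDerivAt (fun ρ : ℝ => ρ / s ^ 2) (1 / s ^ 2) ρ := (hasDerivAt_id ρ).div_const _
  have h2 := (hh.differentiable (by simp)).differentiableAt (x := ρ / s ^ 2) |>.hasDerivAt
  have h3 := (h2.comp ρ h1).const_mul (s ^ N)⁻¹
  have h4 : deriv (scaleProfile N h s) ρ = _ := h3.deriv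
  rw [h4]
  ring

lemma scaleProfile_mollProfile (N : ℕ) {s : ℝ} (hs : 0 < s) (ρ : ℝ) :
    scaleProfile N (mollProfile N) s ρ
      = 2 * ρ * deriv (scaleProfile N (newtonCutoff N) s) ρ
        + N * scaleProfile N (newtonCutoff N) s ρ := by
  rw [deriv_scaleProfile N (contDiff_newtonCutoff N), scaleProfile, scaleProfile, mollProfile]
  field_simp

lemma scaleProfile_mollProfile_of_le (N : ℕ) {s : ℝ} (hs : 0 < s) {ρ : ℝ} (hρ : 3 * s ^ 2 ≤ ρ) :
    scaleProfile N (mollProfile N) s ρ = 0 := by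
  rw [scaleProfile, mollProfile_of_three_le N, mul_zero]
  rw [le_div_iff₀ (by positivity)]
  exact hρ

lemma scaleProfile_newtonCutoff_sq_nonneg (N : ℕ) {s : ℝ} (hs : 0 < s) (r : ℝ) :
    0 ≤ scaleProfile N (newtonCutoff N) s (r ^ 2) := by
  rw [scaleProfile, ← div_pow]
  exact mul_nonneg (by positivity) (newtonCutoff_sq_nonneg N _)

lemma scaleProfile_newtonCutoff_sq_le (N : ℕ) {s : ℝ} (hs : 0 < s) {r : ℝ} (hr : 0 ≤ r) :
    scaleProfile N (newtonCutoff N) s (r ^ 2) ≤ (r ^ N)⁻¹ := by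
  rw [scaleProfile, ← div_pow]
  calc (s ^ N)⁻¹ * newtonCutoff N ((r / s) ^ 2) ≤ (s ^ N)⁻¹ * ((r / s) ^ N)⁻¹ := by
        gcongr
        exact newtonCutoff_sq_le N (by positivity)
    _ = (r ^ N)⁻¹ := by
        rw [← mul_inv, ← mul_pow]
        field_simp

lemma scaleProfile_newtonCutoff_sq_eq (N : ℕ) {s : ℝ} (hs : 0 < s) {r : ℝ} (hr : 0 ≤ r)
    (h : 2 * s ^ 2 ≤ r ^ 2) : scaleProfile N (newtonCutoff N) s (r ^ 2) = (r ^ N)⁻¹ := by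
  rw [scaleProfile, ← div_pow, newtonCutoff_sq_eq N (by positivity), ← mul_inv, ← mul_pow]
  · field_simp
  · rw [div_pow, le_div_iff₀ (by positivity)]
    exact h

lemma scaleProfile_newtonCutoff_sq_eq_zero (N : ℕ) {s : ℝ} (hs : 0 < s) {r : ℝ}
    (h : r ^ 2 ≤ s ^ 2) : scaleProfile N (newtonCutoff N) s (r ^ 2) = 0 := by
  rw [scaleProfile, newtonCutoff_of_le_one N, mul_zero]
  rw [div_le_one (by positivity)]
  exact h

/-- The difference of two smoothed Newtonian fields is minus the gradient of the radial test
function `z ↦ M(|z|²)`, so that the difference of the two mollifiers is minus its Laplacian. -/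
lemma exists_primitive_profile (N : ℕ) {s R : ℝ} (hs : 0 < s) (hsR : s ≤ R) :
    ∃ M : ℝ → ℝ, ContDiff ℝ ∞ M ∧ (∀ ρ, 3 * R ^ 2 ≤ ρ → M ρ = 0) ∧
      ∀ ρ, deriv M ρ = -(scaleProfile N (newtonCutoff N) s ρ
        - scaleProfile N (newtonCutoff N) R ρ) / 2 := by
  have hR : 0 < R := hs.trans_le hsR
  set w : ℝ → ℝ := fun ρ => -(scaleProfile N (newtonCutoff N) s ρ
        - scaleProfile N (newtonCutoff N) R ρ) / 2 with hw
  have hwc : ContDiff ℝ ∞ w :=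
    ((contDiff_scaleProfile N (contDiff_newtonCutoff N) s).sub
      (contDiff_scaleProfile N (contDiff_newtonCutoff N) R)).neg.div_const _
  have hd : ∀ ρ, HasDerivAt (fun ρ => ∫ t in (3 * R ^ 2)..ρ, w t) (w ρ) ρ := fun ρ =>
    intervalIntegral.integral_hasDerivAt_right (hwc.continuous.intervalIntegrable _ _)
      hwc.continuous.stronglyMeasurable.stronglyMeasurableAtFilter hwc.continuous.continuousAt
  refine ⟨fun ρ => ∫ t in (3 * R ^ 2)..ρ, w t, ?_, ?_, fun ρ => (hd ρ).deriv⟩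
  · rw [contDiff_infty_iff_deriv]
    refine ⟨fun ρ => (hd ρ).differentiableAt, ?_⟩
    rw [show deriv (fun ρ => ∫ t in (3 * R ^ 2)..ρ, w t) = w from funext fun ρ => (hd ρ).deriv]
    exact hwc
  · intro ρ hρ
    refine (intervalIntegral.integral_congr (g := fun _ => 0) ?_).trans (by simp)
    intro t ht
    rw [uIcc_of_le hρ] at ht
    have ht0 : 0 ≤ t := (by positivity : (0 : ℝ) ≤ 3 * R ^ 2).trans ht.1
    have ht1 : 2 * R ^ 2 ≤ t := by nlinarith [ht.1]
    have ht2 : 2 * s ^ 2 ≤ t := by nlinarith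
    simp only [hw]
    rw [← Real.sq_sqrt ht0, scaleProfile_newtonCutoff_sq_eq N hs (Real.sqrt_nonneg t),
      scaleProfile_newtonCutoff_sq_eq N hR (Real.sqrt_nonneg t)]
    · simp
    · rwa [Real.sq_sqrt ht0]
    · rwa [Real.sq_sqrt ht0]

/-! ### Second derivatives of the mollified solution -/

section GradRadial

variable {E : Type*} [NormedAddCommGroup E] [InnerProductSpace ℝ E]

/-- The derivative of `z ↦ κ(|z|²)` at `z` in the direction `ξ`. -/
def gradRadial (κ : ℝ → ℝ) (ξ z : E) : ℝ := 2 * deriv κ (‖z‖ ^ 2) * inner ℝ z ξ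

lemma contDiff_gradRadial {κ : ℝ → ℝ} (hκ : ContDiff ℝ ∞ κ) (ξ : E) :
    ContDiff ℝ ∞ (gradRadial κ ξ) :=
  (contDiff_const.mul (contDiff_radial (contDiff_infty_iff_deriv.1 hκ).2)).mul
    (contDiff_id.inner ℝ contDiff_const)

lemma fderiv_radial_eq {κ : ℝ → ℝ} (hκ : ContDiff ℝ ∞ κ) (ξ : E) :
    (fun z => fderiv ℝ (fun z : E => κ (‖z‖ ^ 2)) z ξ) = gradRadial κ ξ :=
  funext fun z => fderiv_radial_apply (hκ.differentiable (by simp)) z ξ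

lemma fderiv_gradRadial_eq {κ : ℝ → ℝ} (hκ : ContDiff ℝ ∞ κ) (ξ η : E) :
    (fun z => fderiv ℝ (gradRadial κ ξ) z η) = hessRadial κ ξ η :=
  funext fun z => fderiv_fderiv_radial_apply (contDiff_infty.1 hκ 2) z ξ η

variable [FiniteDimensional ℝ E]

lemma hasCompactSupport_gradRadial {κ : ℝ → ℝ} (hκ : ContDiff ℝ ∞ κ) {B : ℝ}
    (hB : ∀ ρ, B ≤ ρ → κ ρ = 0) (ξ : E) : HasCompactSupport (gradRadial κ ξ) := by
  rw [← fderiv_radial_eq hκ ξ]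
  exact (hasCompactSupport_radial hB).fderiv_apply ℝ ξ

lemma hasCompactSupport_hessRadial {κ : ℝ → ℝ} (hκ : ContDiff ℝ ∞ κ) {B : ℝ}
    (hB : ∀ ρ, B ≤ ρ → κ ρ = 0) (ξ η : E) : HasCompactSupport (hessRadial κ ξ η) := by
  rw [← fderiv_gradRadial_eq hκ ξ]
  exact (hasCompactSupport_gradRadial hκ hB ξ).fderiv_apply ℝ η

omit [FiniteDimensional ℝ E] in
lemma contDiff_hessRadial {κ : ℝ → ℝ} (hκ : ContDiff ℝ ∞ κ) (ξ η : E) :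
    ContDiff ℝ ∞ (hessRadial κ ξ η) := by
  have h1 := (contDiff_infty_iff_deriv.1 hκ).2
  have h2 := (contDiff_infty_iff_deriv.1 h1).2
  exact ((contDiff_const.mul (contDiff_radial h2)).mul ((contDiff_id.inner ℝ contDiff_const).mul
    (contDiff_id.inner ℝ contDiff_const))).add
    ((contDiff_const.mul (contDiff_radial h1)).mul contDiff_const)

variable [MeasurableSpace E] [BorelSpace E]

lemma hasDerivAt_integral_radial {A : E → ℝ} (hA : LocallyIntegrable A (volume : Measure E))
    {κ : ℝ → ℝ} (hκ : ContDiff ℝ ∞ κ) {B : ℝ} (hB : ∀ ρ, B ≤ ρ → κ ρ = 0) (x ξ : E) (t : ℝ) :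
    HasDerivAt (fun s : ℝ => ∫ y, A y * κ (‖x + s • ξ - y‖ ^ 2))
      (∫ y, A y * gradRadial κ ξ (x + t • ξ - y)) t := by
  rw [← fderiv_radial_eq hκ]
  exact hasDerivAt_integral_mul_comp_sub hA (contDiff_radial (hκ.of_le (m := (1 : ℕ∞)) (by simp)))
    (hasCompactSupport_radial hB) x ξ t

lemma hasDerivAt_integral_gradRadial {A : E → ℝ} (hA : LocallyIntegrable A (volume : Measure E))
    {κ : ℝ → ℝ} (hκ : ContDiff ℝ ∞ κ) {B : ℝ} (hB : ∀ ρ, B ≤ ρ → κ ρ = 0) (x ξ η : E) (t : ℝ) :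
    HasDerivAt (fun s : ℝ => ∫ y, A y * gradRadial κ ξ (x + s • η - y))
      (∫ y, A y * hessRadial κ ξ η (x + t • η - y)) t := by
  rw [← fderiv_gradRadial_eq hκ]
  exact hasDerivAt_integral_mul_comp_sub hA ((contDiff_gradRadial hκ ξ).of_le (by simp))
    (hasCompactSupport_gradRadial hκ hB ξ) x η t

end GradRadial

section Mollify

variable {E : Type*} [NormedAddCommGroup E] [InnerProductSpace ℝ E] [FiniteDimensional ℝ E]
  [MeasurableSpace E] [BorelSpace E] {G U : E → ℝ} {L : NNReal} {c : ℝ}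

/-- The difference of two mollifications of a solution of `Δ U = F` is a smoothing of `F` by a
test function. -/
lemma integral_mollProfile_sub {F : E → ℝ} (hU : LocallyIntegrable U (volume : Measure E))
    (hsol : ∀ φ : E → ℝ, ContDiff ℝ ∞ φ → HasCompactSupport φ →
      ∫ y, U y * (Δ φ) y = ∫ y, F y * φ y)
    {s R : ℝ} (hs : 0 < s) (hR : 0 < R) {M : ℝ → ℝ} (hM : ContDiff ℝ ∞ M) {B : ℝ}
    (hMB : ∀ ρ, B ≤ ρ → M ρ = 0)
    (hdM : ∀ ρ, deriv M ρ = -(scaleProfile (Module.finrank ℝ E)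
      (newtonCutoff (Module.finrank ℝ E)) s ρ - scaleProfile (Module.finrank ℝ E)
        (newtonCutoff (Module.finrank ℝ E)) R ρ) / 2) (x : E) :
    (∫ y, U y * scaleProfile (Module.finrank ℝ E) (mollProfile (Module.finrank ℝ E)) R
        (‖x - y‖ ^ 2))
      - ∫ y, U y * scaleProfile (Module.finrank ℝ E) (mollProfile (Module.finrank ℝ E)) s
        (‖x - y‖ ^ 2)
      = ∫ y, F y * M (‖x - y‖ ^ 2) := by
  set N := Module.finrank ℝ E with hN
  have hint : ∀ r, 0 < r →
      Integrable fun y => U y * scaleProfile N (mollProfile N) r (‖x - y‖ ^ 2) := fun r hr =>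
    integrable_mul_comp_sub (g := fun z => scaleProfile N (mollProfile N) r (‖z‖ ^ 2)) hU
      (contDiff_radial (contDiff_scaleProfile N (contDiff_mollProfile N) r)).continuous
      (hasCompactSupport_radial fun ρ hρ => scaleProfile_mollProfile_of_le N hr hρ) x
  have hφ : ContDiff ℝ ∞ fun y => M (‖x - y‖ ^ 2) :=
    (contDiff_radial hM).comp (contDiff_const.sub contDiff_id)
  have hφs : HasCompactSupport fun y => M (‖x - y‖ ^ 2) :=
    (hasCompactSupport_radial hMB).comp_homeomorph (Homeomorph.subLeft x)
  rw [← hsol _ hφ hφs, ← integral_sub (hint R hR) (hint s hs)]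
  congr 1
  ext y
  have hlap := laplacian_affine_mul_radial (M := M) (contDiff_infty.1 hM 2) 1 0 x y
  simp only [inner_zero_left, add_zero, one_mul, mul_zero, zero_mul] at hlap
  rw [hlap, ← hN, ← mul_sub]
  congr 1
  have hdd : deriv (deriv M) (‖x - y‖ ^ 2) = -(deriv (scaleProfile N (newtonCutoff N) s)
      (‖x - y‖ ^ 2) - deriv (scaleProfile N (newtonCutoff N) R) (‖x - y‖ ^ 2)) / 2 := by
    rw [show deriv M = _ from funext hdM]
    have h1 := ((contDiff_scaleProfile N (contDiff_newtonCutoff N) s).differentiable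
      (by simp)).differentiableAt (x := ‖x - y‖ ^ 2) |>.hasDerivAt
    have h2 := ((contDiff_scaleProfile N (contDiff_newtonCutoff N) R).differentiable
      (by simp)).differentiableAt (x := ‖x - y‖ ^ 2) |>.hasDerivAt
    exact ((h1.sub h2).neg.div_const 2).deriv
  rw [hdd, hdM, scaleProfile_mollProfile N hs, scaleProfile_mollProfile N hR]
  ring

/-- The second derivatives of two mollifications differ by a regularized singular integral of the
first derivative of `F = G⁻¹`. -/
lemma integral_hessRadial_sub (hG : LipschitzWith L G) (hc : 0 < c)
    (hlow : ∀ y, c * ‖y‖ ≤ G y) (hd : 3 ≤ Module.finrank ℝ E)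
    (hU : LocallyIntegrable U (volume : Measure E))
    (hsol : ∀ φ : E → ℝ, ContDiff ℝ ∞ φ → HasCompactSupport φ →
      ∫ y, U y * (Δ φ) y = ∫ y, (G y)⁻¹ * φ y)
    {s R : ℝ} (hs : 0 < s) (hsR : s ≤ R) (x ξ : E) :
    ∫ y, U y * hessRadial (scaleProfile (Module.finrank ℝ E)
        (mollProfile (Module.finrank ℝ E)) s) ξ ξ (x - y)
      = (∫ y, U y * hessRadial (scaleProfile (Module.finrank ℝ E)
          (mollProfile (Module.finrank ℝ E)) R) ξ ξ (x - y))
        + ∫ y, fderiv ℝ (fun z => (G z)⁻¹) y ξ * (inner ℝ (x - y) ξ *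
          (scaleProfile (Module.finrank ℝ E) (newtonCutoff (Module.finrank ℝ E)) s (‖x - y‖ ^ 2)
          - scaleProfile (Module.finrank ℝ E) (newtonCutoff (Module.finrank ℝ E)) R
            (‖x - y‖ ^ 2))) := by
  have hR : 0 < R := hs.trans_le hsR
  obtain ⟨M, hM, hMB, hdM⟩ := exists_primitive_profile (Module.finrank ℝ E) hs hsR
  have hF := locallyIntegrable_inv hG hc hlow hd
  have h0 := integral_mollProfile_sub hU hsol hs hR hM hMB hdM
  set N := Module.finrank ℝ E with hN
  have hk : ∀ r, ContDiff ℝ ∞ (scaleProfile N (mollProfile N) r) :=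
    contDiff_scaleProfile N (contDiff_mollProfile N)
  have hkB := fun (r : ℝ) (hr : 0 < r) (ρ : ℝ) (hρ : 3 * r ^ 2 ≤ ρ) =>
    scaleProfile_mollProfile_of_le N hr hρ
  have h1 : ∀ x, (∫ y, U y * gradRadial (scaleProfile N (mollProfile N) R) ξ (x - y))
      - ∫ y, U y * gradRadial (scaleProfile N (mollProfile N) s) ξ (x - y)
      = ∫ y, (G y)⁻¹ * gradRadial M ξ (x - y) := by
    intro x
    have hL := (hasDerivAt_integral_radial hU (hk R) (hkB R hR) x ξ 0).sub
      (hasDerivAt_integral_radial hU (hk s) (hkB s hs) x ξ 0)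
    have hRr := hasDerivAt_integral_radial hF hM hMB x ξ 0
    have := (hL.congr_of_eventuallyEq (.of_forall fun t => (h0 (x + t • ξ)).symm)).unique hRr
    simpa using this
  have h2 : (∫ y, U y * hessRadial (scaleProfile N (mollProfile N) R) ξ ξ (x - y))
      - ∫ y, U y * hessRadial (scaleProfile N (mollProfile N) s) ξ ξ (x - y)
      = ∫ y, (G y)⁻¹ * hessRadial M ξ ξ (x - y) := by
    have hL := (hasDerivAt_integral_gradRadial hU (hk R) (hkB R hR) x ξ ξ 0).sub
      (hasDerivAt_integral_gradRadial hU (hk s) (hkB s hs) x ξ ξ 0)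
    have hRr := hasDerivAt_integral_gradRadial hF hM hMB x ξ ξ 0
    have := (hL.congr_of_eventuallyEq (.of_forall fun t => (h1 (x + t • ξ)).symm)).unique hRr
    simpa using this
  have h3 : ∫ y, (G y)⁻¹ * hessRadial M ξ ξ (x - y)
      = ∫ y, fderiv ℝ (fun z => (G z)⁻¹) y ξ * gradRadial M ξ (x - y) := by
    have hg : ContDiff ℝ ∞ fun y => gradRadial M ξ (x - y) :=
      (contDiff_gradRadial hM ξ).comp (contDiff_const.sub contDiff_id)
    have hgs : HasCompactSupport fun y => gradRadial M ξ (x - y) :=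
      (hasCompactSupport_gradRadial hM hMB ξ).comp_homeomorph (Homeomorph.subLeft x)
    have := integral_inv_mul_fderiv hG hc hlow hd (hg.of_le (by simp)) hgs ξ
    have hfd : ∀ y, fderiv ℝ (fun y => gradRadial M ξ (x - y)) y ξ
        = -hessRadial M ξ ξ (x - y) := by
      intro y
      rw [← fderiv_gradRadial_eq hM]
      have hgd := ((contDiff_gradRadial hM ξ).differentiable (by simp)).differentiableAt
        (x := x - y) |>.hasFDerivAt
      have hsub : HasFDerivAt (fun y : E => x - y) (-ContinuousLinearMap.id ℝ E) y :=
        (hasFDerivAt_id y).const_sub x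
      rw [show fderiv ℝ (fun y => gradRadial M ξ (x - y)) y = _ from (hgd.comp y hsub).fderiv]
      simp
    simp only [hfd, mul_neg, integral_neg, neg_inj] at this
    exact this
  have h4 : ∀ y, gradRadial M ξ (x - y) = -(inner ℝ (x - y) ξ *
      (scaleProfile N (newtonCutoff N) s (‖x - y‖ ^ 2)
        - scaleProfile N (newtonCutoff N) R (‖x - y‖ ^ 2))) := by
    intro y
    rw [gradRadial, hdM]
    ring
  simp only [h4, mul_neg, integral_neg] at h3
  rw [h3] at h2
  linarith

end Mollify

/-! ### Convergence of the mollified second derivatives -/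

section Singular

variable {E : Type*} [NormedAddCommGroup E] [InnerProductSpace ℝ E] [FiniteDimensional ℝ E]
  [MeasurableSpace E] [BorelSpace E]

lemma integrable_inv_norm_pow_mul_max {k l : ℕ} (hk : k + 1 ≤ Module.finrank ℝ E)
    (hkl : k + l = Module.finrank ℝ E + 1) {r : ℝ} (hr : 0 < r) :
    Integrable (fun y : E => (‖y‖ ^ k)⁻¹ * (max ‖y‖ r ^ l)⁻¹) := by
  have : Nontrivial E := Module.nontrivial_of_finrank_pos (R := ℝ) (by lia)
  rw [integrable_fun_norm_addHaar (volume : Measure E)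
    (f := fun a => (a ^ k)⁻¹ * (max a r ^ l)⁻¹)]
  have hdom : IntegrableOn (fun a : ℝ => (1 / r ^ 2 + 1) * (1 + a ^ 2)⁻¹) (Ioi 0) :=
    (integrable_inv_one_add_sq.const_mul _).integrableOn
  refine Integrable.mono' hdom ?_ ?_
  · exact (by fun_prop : Measurable fun a : ℝ => a ^ (Module.finrank ℝ E - 1) •
      ((a ^ k)⁻¹ * (max a r ^ l)⁻¹)).aestronglyMeasurable
  · filter_upwards [ae_restrict_mem measurableSet_Ioi] with a ha
    have ha : 0 < a := ha
    obtain ⟨j, hj⟩ := Nat.exists_eq_add_of_le hk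
    have hl : l = j + 2 := by lia
    have hm : 0 < max a r := lt_max_of_lt_left ha
    have hdim : Module.finrank ℝ E - 1 = k + j := by lia
    rw [smul_eq_mul, Real.norm_of_nonneg (by positivity), hdim, hl, pow_add, pow_add]
    calc a ^ k * a ^ j * ((a ^ k)⁻¹ * (max a r ^ j * max a r ^ 2)⁻¹)
        = (a ^ j / max a r ^ j) * (max a r ^ 2)⁻¹ := by
          field_simp
      _ ≤ 1 * (max a r ^ 2)⁻¹ := by
          gcongr
          rw [div_le_one (by positivity)]
          gcongr
          exact le_max_left _ _
      _ ≤ (1 / r ^ 2 + 1) * (1 + a ^ 2)⁻¹ := by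
          rw [one_mul, ← div_eq_mul_inv, le_div_iff₀ (by positivity),
            inv_mul_le_iff₀ (by positivity)]
          have h1 : a ^ 2 ≤ max a r ^ 2 := by gcongr; exact le_max_left _ _
          have h2 : 1 ≤ max a r ^ 2 * (1 / r ^ 2) := by
            rw [mul_one_div, le_div_iff₀ (by positivity), one_mul]
            gcongr
            exact le_max_right _ _
          linarith

/-- The product of the singularities of the derivative of a `(-1)`-homogeneous function and of the
gradient of the fundamental solution is integrable. At each `y`, one of `|y|` and `|x - y|` is at
least `|x| / 2`, and the product is dominated by a sum of two radial functions with different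
centres. -/
lemma integrable_inv_sq_mul_inv_pow (hd : 3 ≤ Module.finrank ℝ E) {x : E} (hx : x ≠ 0) :
    Integrable fun y : E => (‖y‖ ^ 2)⁻¹ * (‖x - y‖ ^ (Module.finrank ℝ E - 1))⁻¹ := by
  set N := Module.finrank ℝ E with hN
  have hr : 0 < ‖x‖ / 2 := half_pos (norm_pos_iff.2 hx)
  have i1 : Integrable (fun y : E => (‖y‖ ^ 2)⁻¹ * (max ‖y‖ (‖x‖ / 2) ^ (N - 1))⁻¹) :=
    integrable_inv_norm_pow_mul_max (by lia) (by lia) hr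
  have i2 : Integrable (fun y : E => (‖y‖ ^ (N - 1))⁻¹ * (max ‖y‖ (‖x‖ / 2) ^ 2)⁻¹) :=
    integrable_inv_norm_pow_mul_max (by lia) (by lia) hr
  have i3 := i2.comp_sub_left x
  refine (i1.add i3).mono' ?_ ?_
  · exact (by fun_prop : Measurable fun y : E =>
      (‖y‖ ^ 2)⁻¹ * (‖x - y‖ ^ (N - 1))⁻¹).aestronglyMeasurable
  · refine .of_forall fun y => ?_
    rw [Real.norm_of_nonneg (by positivity)]
    simp only [Pi.add_apply]
    have htri : ‖x‖ ≤ ‖y‖ + ‖x - y‖ := by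
      have := norm_add_le y (x - y)
      rwa [add_sub_cancel] at this
    rcases le_total ‖y‖ ‖x - y‖ with h | h
    · have hm : max ‖y‖ (‖x‖ / 2) ≤ ‖x - y‖ := max_le h (by linarith)
      have hmp : 0 < max ‖y‖ (‖x‖ / 2) := lt_max_of_lt_right hr
      have : (‖x - y‖ ^ (N - 1))⁻¹ ≤ (max ‖y‖ (‖x‖ / 2) ^ (N - 1))⁻¹ := by gcongr
      have h2 : (‖y‖ ^ 2)⁻¹ * (‖x - y‖ ^ (N - 1))⁻¹
          ≤ (‖y‖ ^ 2)⁻¹ * (max ‖y‖ (‖x‖ / 2) ^ (N - 1))⁻¹ := by gcongr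
      have h3 : 0 ≤ (‖x - y‖ ^ (N - 1))⁻¹ * (max ‖x - y‖ (‖x‖ / 2) ^ 2)⁻¹ := by positivity
      linarith
    · have hm : max ‖x - y‖ (‖x‖ / 2) ≤ ‖y‖ := max_le h (by linarith)
      have hmp : 0 < max ‖x - y‖ (‖x‖ / 2) := lt_max_of_lt_right hr
      have : (‖y‖ ^ 2)⁻¹ ≤ (max ‖x - y‖ (‖x‖ / 2) ^ 2)⁻¹ := by gcongr
      have h2 : (‖y‖ ^ 2)⁻¹ * (‖x - y‖ ^ (N - 1))⁻¹
          ≤ (max ‖x - y‖ (‖x‖ / 2) ^ 2)⁻¹ * (‖x - y‖ ^ (N - 1))⁻¹ := by gcongr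
      have h3 : 0 ≤ (‖y‖ ^ 2)⁻¹ * (max ‖y‖ (‖x‖ / 2) ^ (N - 1))⁻¹ := by positivity
      linarith

omit [FiniteDimensional ℝ E] [MeasurableSpace E] [BorelSpace E] in
lemma abs_inner_mul_inv_norm_pow_le {N : ℕ} (hN : 1 ≤ N) (z ξ : E) {q : ℝ}
    (hq : |q| ≤ (‖z‖ ^ N)⁻¹) : |inner ℝ z ξ * q| ≤ ‖ξ‖ * (‖z‖ ^ (N - 1))⁻¹ := by
  by_cases hz : z = 0
  · simp [hz]; positivity
  have hz := norm_pos_iff.2 hz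
  rw [abs_mul]
  calc |inner ℝ z ξ| * |q| ≤ (‖z‖ * ‖ξ‖) * (‖z‖ ^ N)⁻¹ := by
        gcongr
        exact abs_real_inner_le_norm z ξ
    _ = ‖ξ‖ * (‖z‖ ^ (N - 1))⁻¹ := by
        obtain ⟨j, rfl⟩ := Nat.exists_eq_add_of_le hN
        rw [Nat.add_sub_cancel_left, pow_add, pow_one]
        field_simp

lemma integral_mul_comp_inv_smul_sub (A g : E → ℝ) {R : ℝ} (hR : 0 < R) (x : E) :
    ∫ y, A y * g (R⁻¹ • (x - y))
      = R ^ (Module.finrank ℝ E) * ∫ z, A (x - R • z) * g z := by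
  have h1 := integral_sub_left_eq_self (fun y => A y * g (R⁻¹ • (x - y))) (volume : Measure E) x
  have h2 := Measure.integral_comp_smul (volume : Measure E) (fun z => A (x - z) * g (R⁻¹ • z)) R
  simp only [sub_sub_cancel] at h1
  rw [← h1]
  simp only [smul_smul, inv_mul_cancel₀ hR.ne', one_smul] at h2
  rw [h2, abs_of_pos (by positivity), smul_eq_mul, ← mul_assoc, mul_inv_cancel₀ (by positivity),
    one_mul]

lemma setIntegral_inv_norm_pow_closedBall (hd : 1 ≤ Module.finrank ℝ E) {s : ℝ} (hs : 0 < s) :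
    ∫ z in closedBall (0 : E) (2 * s), (‖z‖ ^ (Module.finrank ℝ E - 1))⁻¹
      = s * ∫ z in closedBall (0 : E) 2, (‖z‖ ^ (Module.finrank ℝ E - 1))⁻¹ := by
  have h := Measure.setIntegral_comp_smul_of_pos (volume : Measure E)
    (fun z : E => (‖z‖ ^ (Module.finrank ℝ E - 1))⁻¹) (closedBall (0 : E) 2) hs
  rw [smul_closedBall _ _ (by norm_num : (0 : ℝ) ≤ 2), smul_zero, Real.norm_of_nonneg hs.le,
    mul_comm s 2] at h
  have h2 : (fun z : E => (‖s • z‖ ^ (Module.finrank ℝ E - 1))⁻¹)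
      = fun z => (s ^ (Module.finrank ℝ E - 1))⁻¹ * (‖z‖ ^ (Module.finrank ℝ E - 1))⁻¹ := by
    ext z
    rw [norm_smul, Real.norm_of_nonneg hs.le, mul_pow, mul_inv]
  rw [h2, integral_const_mul, smul_eq_mul] at h
  obtain ⟨j, hj⟩ := Nat.exists_eq_add_of_le hd
  rw [hj, Nat.add_sub_cancel_left] at h ⊢
  rw [pow_add, pow_one] at h
  have hsj : s ^ j ≠ 0 := by positivity
  calc _ = (s ^ j * s) * ((s * s ^ j)⁻¹ *
        ∫ z in closedBall (0 : E) (2 * s), (‖z‖ ^ j)⁻¹) := by field_simp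
    _ = _ := by rw [← h]; field_simp

omit [FiniteDimensional ℝ E] [MeasurableSpace E] [BorelSpace E] in
lemma hessRadial_scaleProfile (N : ℕ) {h : ℝ → ℝ} (hh : ContDiff ℝ ∞ h) {R : ℝ} (hR : 0 < R)
    (ξ η z : E) : hessRadial (scaleProfile N h R) ξ η z
      = (R ^ N)⁻¹ * (R ^ 2)⁻¹ * hessRadial h ξ η (R⁻¹ • z) := by
  have h1 : deriv (scaleProfile N h R) = fun ρ => (R ^ N)⁻¹ * (deriv h (ρ / R ^ 2) / R ^ 2) :=
    funext fun ρ => deriv_scaleProfile N hh R ρ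
  have h2 : ∀ ρ, deriv (deriv (scaleProfile N h R)) ρ
      = (R ^ 2)⁻¹ * ((R ^ N)⁻¹ * (deriv (deriv h) (ρ / R ^ 2) / R ^ 2)) := by
    intro ρ
    rw [← deriv_scaleProfile N (contDiff_infty_iff_deriv.1 hh).2, h1]
    rw [show (fun ρ => (R ^ N)⁻¹ * (deriv h (ρ / R ^ 2) / R ^ 2))
      = fun ρ => (R ^ 2)⁻¹ * scaleProfile N (deriv h) R ρ by
        ext ρ; rw [scaleProfile]; ring]
    exact deriv_const_mul _ ((contDiff_scaleProfile N (contDiff_infty_iff_deriv.1 hh).2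
      R).differentiable (by simp)).differentiableAt
  have h3 : ‖R⁻¹ • z‖ ^ 2 = ‖z‖ ^ 2 / R ^ 2 := by
    rw [norm_smul, norm_inv, Real.norm_of_nonneg hR.le, mul_pow, inv_pow]
    field_simp
  rw [hessRadial, hessRadial, h2, h1, h3, inner_smul_left, inner_smul_left]
  simp only [map_inv₀, conj_trivial]
  field_simp

end Singular

section Limit

variable {E : Type*} [NormedAddCommGroup E] [InnerProductSpace ℝ E] [FiniteDimensional ℝ E]
  [MeasurableSpace E] [BorelSpace E] {G U : E → ℝ} {L : NNReal} {c B : ℝ}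

/-- Mollifications at large scale of a function of linear growth have small second derivatives. -/
lemma tendsto_integral_hessRadial_atTop (hB0 : 0 ≤ B)
    (hB : ∀ y, |U y| ≤ B * ‖y‖) (x ξ : E) :
    Tendsto (fun R : ℝ => ∫ y, U y * hessRadial (scaleProfile (Module.finrank ℝ E)
      (mollProfile (Module.finrank ℝ E)) R) ξ ξ (x - y)) atTop (𝓝 0) := by
  set N := Module.finrank ℝ E with hN
  set H : E → ℝ := hessRadial (mollProfile N) ξ ξ with hH
  have hHc : Continuous H := (contDiff_hessRadial (contDiff_mollProfile N) ξ ξ).continuous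
  have hHs : HasCompactSupport H := hasCompactSupport_hessRadial (contDiff_mollProfile N)
    (fun ρ hρ => mollProfile_of_three_le N hρ) ξ ξ
  have i0 : Integrable fun z => ‖x‖ * |H z| :=
    (hHc.abs.integrable_of_hasCompactSupport hHs.norm).const_mul _
  have i1 : Integrable fun z => ‖z‖ * |H z| :=
    (continuous_norm.mul hHc.abs).integrable_of_hasCompactSupport hHs.norm.mul_left
  have hbd : ∀ R : ℝ, 0 < R → |∫ y, U y * hessRadial (scaleProfile N (mollProfile N) R) ξ ξ (x - y)|
      ≤ (R ^ 2)⁻¹ * (B * ((∫ z, ‖x‖ * |H z|) + R * ∫ z, ‖z‖ * |H z|)) := by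
    intro R hR
    have e1 : ∫ y, U y * hessRadial (scaleProfile N (mollProfile N) R) ξ ξ (x - y)
        = (R ^ 2)⁻¹ * ∫ z, U (x - R • z) * H z := by
      have e2 : ∀ y, U y * hessRadial (scaleProfile N (mollProfile N) R) ξ ξ (x - y)
          = ((R ^ N)⁻¹ * (R ^ 2)⁻¹) * (U y * H (R⁻¹ • (x - y))) := by
        intro y
        rw [hessRadial_scaleProfile N (contDiff_mollProfile N) hR]
        ring
      simp only [e2]
      rw [integral_const_mul, integral_mul_comp_inv_smul_sub U H hR x, ← hN]
      field_simp
    rw [e1, abs_mul, abs_of_pos (by positivity)]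
    refine mul_le_mul_of_nonneg_left ?_ (by positivity)
    rw [← integral_const_mul R, ← integral_add i0 (i1.const_mul R), ← integral_const_mul]
    rw [← Real.norm_eq_abs]
    refine norm_integral_le_of_norm_le ((i0.add (i1.const_mul R)).const_mul B)
      (.of_forall fun z => ?_)
    rw [norm_mul, Real.norm_eq_abs, Real.norm_eq_abs]
    have hle : ‖x - R • z‖ ≤ ‖x‖ + R * ‖z‖ := by
      refine (norm_sub_le _ _).trans_eq ?_
      rw [norm_smul, Real.norm_of_nonneg hR.le]
    calc |U (x - R • z)| * |H z| ≤ (B * (‖x‖ + R * ‖z‖)) * |H z| := by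
          gcongr
          exact (hB _).trans (by gcongr)
      _ = _ := by ring
  refine squeeze_zero_norm' (a := fun R : ℝ => (B * ∫ z, ‖x‖ * |H z|) * (R⁻¹) ^ 2
    + (B * ∫ z, ‖z‖ * |H z|) * R⁻¹) ?_ ?_
  · filter_upwards [eventually_gt_atTop 0] with R hR
    refine (hbd R hR).trans_eq ?_
    field_simp
  · have h1 := tendsto_inv_atTop_zero (𝕜 := ℝ)
    have := ((h1.pow 2).const_mul (B * ∫ z, ‖x‖ * |H z|)).add
      (h1.const_mul (B * ∫ z, ‖z‖ * |H z|))
    simpa using this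

/-- The integrand of the singular integral representing the second derivative of the solution is
integrable, also when the kernel `|x - y|^{-N}` is replaced by a smaller function. -/
lemma integrable_fderiv_inv_mul (hG : LipschitzWith L G) (hc : 0 < c)
    (hlow : ∀ y, c * ‖y‖ ≤ G y) (hd : 3 ≤ Module.finrank ℝ E) {x : E} (hx : x ≠ 0) (ξ : E)
    {q : E → ℝ} (hqm : Measurable q) (hq : ∀ y, |q y| ≤ (‖x - y‖ ^ Module.finrank ℝ E)⁻¹) :
    Integrable fun y => fderiv ℝ (fun z => (G z)⁻¹) y ξ * (inner ℝ (x - y) ξ * q y) := by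
  have : Nontrivial E := Module.nontrivial_of_finrank_pos (R := ℝ) (by lia)
  refine ((integrable_inv_sq_mul_inv_pow hd hx).const_mul (L / c ^ 2 * ‖ξ‖ * ‖ξ‖)).mono' ?_ ?_
  · refine ((measurable_fderiv_apply_const ℝ _ ξ).mul (Measurable.mul ?_ hqm)).aestronglyMeasurable
    exact (by fun_prop : Continuous fun y => inner ℝ (x - y) ξ).measurable
  · filter_upwards [Measure.ae_ne volume (0 : E)] with y hy
    rw [norm_mul, Real.norm_eq_abs, Real.norm_eq_abs]
    calc |fderiv ℝ (fun z => (G z)⁻¹) y ξ| * |inner ℝ (x - y) ξ * q y|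
        ≤ (L / c ^ 2 * ‖ξ‖ * (‖y‖ ^ 2)⁻¹) *
          (‖ξ‖ * (‖x - y‖ ^ (Module.finrank ℝ E - 1))⁻¹) := by
          gcongr
          · exact abs_fderiv_inv_le hG hc hlow hy ξ
          · exact abs_inner_mul_inv_norm_pow_le (by lia) _ _ (hq y)
      _ = _ := by ring

/-- The second derivative of a mollification at scale `s`, as a regularized singular integral. -/
lemma integral_hessRadial_eq (hG : LipschitzWith L G) (hc : 0 < c)
    (hlow : ∀ y, c * ‖y‖ ≤ G y) (hd : 3 ≤ Module.finrank ℝ E) (hU : Continuous U) (hB0 : 0 ≤ B)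
    (hB : ∀ y, |U y| ≤ B * ‖y‖)
    (hsol : ∀ φ : E → ℝ, ContDiff ℝ ∞ φ → HasCompactSupport φ →
      ∫ y, U y * (Δ φ) y = ∫ y, (G y)⁻¹ * φ y)
    {s : ℝ} (hs : 0 < s) {x : E} (hx : x ≠ 0) (ξ : E) :
    ∫ y, U y * hessRadial (scaleProfile (Module.finrank ℝ E)
        (mollProfile (Module.finrank ℝ E)) s) ξ ξ (x - y)
      = ∫ y, fderiv ℝ (fun z => (G z)⁻¹) y ξ * (inner ℝ (x - y) ξ *
          scaleProfile (Module.finrank ℝ E) (newtonCutoff (Module.finrank ℝ E)) s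
            (‖x - y‖ ^ 2)) := by
  set N := Module.finrank ℝ E with hN
  have hqm : ∀ r, Measurable fun y => scaleProfile N (newtonCutoff N) r (‖x - y‖ ^ 2) := fun r =>
    ((contDiff_scaleProfile N (contDiff_newtonCutoff N) r).continuous.comp
      (by fun_prop : Continuous fun y => ‖x - y‖ ^ 2)).measurable
  have hlim : Tendsto (fun R : ℝ => (∫ y, U y * hessRadial (scaleProfile N
        (mollProfile N) R) ξ ξ (x - y))
        + ∫ y, fderiv ℝ (fun z => (G z)⁻¹) y ξ * (inner ℝ (x - y) ξ *
          (scaleProfile N (newtonCutoff N) s (‖x - y‖ ^ 2)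
          - scaleProfile N (newtonCutoff N) R (‖x - y‖ ^ 2)))) atTop
      (𝓝 (0 + ∫ y, fderiv ℝ (fun z => (G z)⁻¹) y ξ * (inner ℝ (x - y) ξ *
          scaleProfile N (newtonCutoff N) s (‖x - y‖ ^ 2)))) := by
    refine (tendsto_integral_hessRadial_atTop hB0 hB x ξ).add ?_
    refine tendsto_integral_filter_of_dominated_convergence
      (fun y => |fderiv ℝ (fun z => (G z)⁻¹) y ξ * (inner ℝ (x - y) ξ * (‖x - y‖ ^ N)⁻¹)|)
      ?_ ?_ ?_ ?_
    · refine .of_forall fun R => ?_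
      refine ((measurable_fderiv_apply_const ℝ _ ξ).mul
        (Measurable.mul ?_ ((hqm s).sub (hqm R)))).aestronglyMeasurable
      exact (by fun_prop : Continuous fun y => inner ℝ (x - y) ξ).measurable
    · filter_upwards [eventually_gt_atTop 0] with R hR
      refine .of_forall fun y => ?_
      rw [Real.norm_eq_abs, abs_mul, abs_mul, abs_mul, abs_mul]
      have h1 := scaleProfile_newtonCutoff_sq_nonneg N hs ‖x - y‖
      have h2 := scaleProfile_newtonCutoff_sq_le N hs (norm_nonneg (x - y))
      have h3 := scaleProfile_newtonCutoff_sq_nonneg N hR ‖x - y‖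
      have h4 := scaleProfile_newtonCutoff_sq_le N hR (norm_nonneg (x - y))
      have h5 : |scaleProfile N (newtonCutoff N) s (‖x - y‖ ^ 2)
          - scaleProfile N (newtonCutoff N) R (‖x - y‖ ^ 2)| ≤ |(‖x - y‖ ^ N)⁻¹| := by
        refine (abs_le.2 ⟨by linarith, by linarith⟩ : _ ≤ (‖x - y‖ ^ N)⁻¹).trans (le_abs_self _)
      gcongr
    · refine (integrable_fderiv_inv_mul hG hc hlow hd hx ξ (q := fun y => (‖x - y‖ ^ N)⁻¹)
        (by fun_prop) fun y => ?_).abs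
      rw [abs_of_nonneg (by positivity)]
    · refine .of_forall fun y => ?_
      refine tendsto_const_nhds.congr' ?_
      filter_upwards [eventually_gt_atTop 0, eventually_ge_atTop ‖x - y‖] with R hR hR2
      rw [scaleProfile_newtonCutoff_sq_eq_zero N hR, sub_zero]
      gcongr
  rw [zero_add] at hlim
  refine tendsto_nhds_unique (tendsto_const_nhds.congr' ?_) hlim
  filter_upwards [eventually_ge_atTop s] with R hR
  exact integral_hessRadial_sub hG hc hlow hd (hU.locallyIntegrable) hsol hs hR x ξ

/-- The second derivatives of the mollifications converge, locally uniformly away from the origin,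
to the singular integral of the derivative of `F = G⁻¹` against the gradient of the fundamental
solution. -/
lemma exists_abs_integral_hessRadial_sub_le (hG : LipschitzWith L G) (hc : 0 < c)
    (hlow : ∀ y, c * ‖y‖ ≤ G y) (hd : 3 ≤ Module.finrank ℝ E) (hU : Continuous U) (hB0 : 0 ≤ B)
    (hB : ∀ y, |U y| ≤ B * ‖y‖)
    (hsol : ∀ φ : E → ℝ, ContDiff ℝ ∞ φ → HasCompactSupport φ →
      ∫ y, U y * (Δ φ) y = ∫ y, (G y)⁻¹ * φ y) :
    ∃ K, 0 ≤ K ∧ ∀ (r s : ℝ) (x ξ : E), 0 < r → r ≤ ‖x‖ → 0 < s → 4 * s ≤ r →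
      |(∫ y, U y * hessRadial (scaleProfile (Module.finrank ℝ E)
        (mollProfile (Module.finrank ℝ E)) s) ξ ξ (x - y))
        - ∫ y, fderiv ℝ (fun z => (G z)⁻¹) y ξ * (inner ℝ (x - y) ξ *
            (‖x - y‖ ^ Module.finrank ℝ E)⁻¹)| ≤ K * s * ‖ξ‖ ^ 2 / r ^ 2 := by
  set N := Module.finrank ℝ E with hN
  set σ := ∫ z in closedBall (0 : E) 2, (‖z‖ ^ (N - 1))⁻¹ with hσ
  have hσ0 : 0 ≤ σ := integral_nonneg fun z => by positivity
  refine ⟨L / c ^ 2 * 4 * σ, by positivity, ?_⟩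
  intro r s x ξ hr hrx hs hsr
  have hx : x ≠ 0 := norm_pos_iff.1 (hr.trans_le hrx)
  rw [integral_hessRadial_eq hG hc hlow hd hU hB0 hB hsol hs hx ξ, ← hN, ← integral_sub]
  rotate_left
  · refine integrable_fderiv_inv_mul hG hc hlow hd hx ξ ?_ ?_
    · exact ((contDiff_scaleProfile N (contDiff_newtonCutoff N) s).continuous.comp
        (by fun_prop : Continuous fun y => ‖x - y‖ ^ 2)).measurable
    · intro y
      rw [abs_of_nonneg (scaleProfile_newtonCutoff_sq_nonneg N hs _)]
      exact scaleProfile_newtonCutoff_sq_le N hs (norm_nonneg _)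
  · refine integrable_fderiv_inv_mul hG hc hlow hd hx ξ (by fun_prop) fun y => ?_
    rw [abs_of_nonneg (by positivity)]
  have hloc : LocallyIntegrable (fun z : E => (‖z‖ ^ (N - 1))⁻¹) (volume : Measure E) :=
    locallyIntegrable_inv_norm_pow (by lia)
  have hi : Integrable ((closedBall (0 : E) (2 * s)).indicator fun z => (‖z‖ ^ (N - 1))⁻¹) :=
    (integrable_indicator_iff measurableSet_closedBall).2
      (hloc.integrableOn_isCompact (isCompact_closedBall _ _))
  have hdom := (hi.comp_sub_left x).const_mul (L / c ^ 2 * 4 * ‖ξ‖ ^ 2 / r ^ 2)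
  have hval : ∫ y, L / c ^ 2 * 4 * ‖ξ‖ ^ 2 / r ^ 2 *
      (closedBall (0 : E) (2 * s)).indicator (fun z => (‖z‖ ^ (N - 1))⁻¹) (x - y)
      = L / c ^ 2 * 4 * σ * s * ‖ξ‖ ^ 2 / r ^ 2 := by
    rw [integral_const_mul, integral_sub_left_eq_self
      ((closedBall (0 : E) (2 * s)).indicator (fun z => (‖z‖ ^ (N - 1))⁻¹)) volume x,
      integral_indicator measurableSet_closedBall,
      setIntegral_inv_norm_pow_closedBall (by lia) hs, ← hN, ← hσ]
    ring
  rw [← hval, ← Real.norm_eq_abs]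
  refine norm_integral_le_of_norm_le hdom (.of_forall fun y => ?_)
  rw [← mul_sub, ← mul_sub, norm_mul, Real.norm_eq_abs, Real.norm_eq_abs]
  by_cases hxy : ‖x - y‖ ≤ 2 * s
  · rw [indicator_of_mem (mem_closedBall_zero_iff.2 hxy)]
    have hyr : r / 2 ≤ ‖y‖ := by
      have := norm_sub_norm_le x (x - y)
      rw [sub_sub_cancel] at this
      linarith
    have hy : y ≠ 0 := norm_pos_iff.1 (by linarith)
    have h1 := scaleProfile_newtonCutoff_sq_nonneg N hs ‖x - y‖
    have h2 := scaleProfile_newtonCutoff_sq_le N hs (norm_nonneg (x - y))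
    calc _ ≤ (L / c ^ 2 * ‖ξ‖ * (‖y‖ ^ 2)⁻¹) * (‖ξ‖ * (‖x - y‖ ^ (N - 1))⁻¹) := by
          gcongr
          · exact abs_fderiv_inv_le hG hc hlow hy ξ
          · refine abs_inner_mul_inv_norm_pow_le (by lia) _ _ (abs_le.2 ⟨?_, ?_⟩) <;> linarith
      _ ≤ (L / c ^ 2 * ‖ξ‖ * ((r / 2) ^ 2)⁻¹) * (‖ξ‖ * (‖x - y‖ ^ (N - 1))⁻¹) := by gcongr
      _ = _ := by field_simp; ring
  · rw [indicator_of_notMem (by rwa [mem_closedBall_zero_iff]), mul_zero,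
      scaleProfile_newtonCutoff_sq_eq N hs (norm_nonneg _), sub_self, mul_zero, abs_zero, mul_zero]
    nlinarith

end Limit

/-! ### Euler's relation for the mollified second derivatives -/

section Euler

variable {E : Type*} [NormedAddCommGroup E] [InnerProductSpace ℝ E] [FiniteDimensional ℝ E]
  [MeasurableSpace E] [BorelSpace E] {G U : E → ℝ} {L : NNReal} {c B : ℝ}

/-- Euler's relation `y · ∇U = U` for a `1`-homogeneous function, in the sense of distributions. -/
lemma integral_mul_fderiv_self_of_homogeneous (hU : Continuous U)
    (hhom : ∀ l : ℝ, 0 < l → ∀ y, U (l • y) = l * U y) {g : E → ℝ} (hg : ContDiff ℝ 1 g)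
    (hgs : HasCompactSupport g) :
    ∫ y, U y * fderiv ℝ g y y = -((Module.finrank ℝ E + 1) * ∫ y, U y * g y) := by
  set N := Module.finrank ℝ E with hN
  have hscale : ∀ l : ℝ, 0 < l → ∫ y, U y * g (l • y) = (l ^ (N + 1))⁻¹ * ∫ y, U y * g y := by
    intro l hl
    have h1 := Measure.integral_comp_smul (volume : Measure E) (fun w => U (l⁻¹ • w) * g w) l
    simp only [smul_smul, inv_mul_cancel₀ hl.ne', one_smul] at h1
    rw [h1, abs_of_pos (by positivity), smul_eq_mul]
    simp only [hhom l⁻¹ (inv_pos.2 hl), mul_assoc]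
    rw [integral_const_mul, pow_succ, ← hN]
    field_simp
  have hd1 : HasDerivAt (fun l : ℝ => ∫ y, U y * g (l • y)) (-((N + 1) * ∫ y, U y * g y)) 1 := by
    have h1 : HasDerivAt (fun l : ℝ => (l ^ (N + 1))⁻¹) (-(N + 1)) 1 := by
      have := (hasDerivAt_pow (N + 1) (1 : ℝ)).fun_inv (by simp)
      simpa using this
    have h2 := h1.mul_const (∫ y, U y * g y)
    have h3 : (fun l : ℝ => (l ^ (N + 1))⁻¹ * ∫ y, U y * g y)
        =ᶠ[𝓝 1] fun l : ℝ => ∫ y, U y * g (l • y) := by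
      filter_upwards [lt_mem_nhds (zero_lt_one (α := ℝ))] with l hl
      exact (hscale l hl).symm
    have := h2.congr_of_eventuallyEq h3.symm
    refine this.congr_deriv (by ring)
  obtain ⟨R, hR0, hR⟩ := hgs.isCompact.isBounded.subset_closedBall_lt 0 (0 : E)
  obtain ⟨C, hC⟩ := (hg.continuous_fderiv one_ne_zero).bounded_above_of_compact_support
    (hgs.fderiv ℝ)
  have hC0 : 0 ≤ C := (norm_nonneg _).trans (hC 0)
  have hd2 : HasDerivAt (fun l : ℝ => ∫ y, U y * g (l • y))
      (∫ y, U y * fderiv ℝ g ((1 : ℝ) • y) y) 1 := by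
    have hcd : ∀ l : ℝ, Continuous fun y => U y * g (l • y) := fun l =>
      hU.mul (hg.continuous.comp (continuous_const_smul l))
    refine (hasDerivAt_integral_of_dominated_loc_of_deriv_le (μ := (volume : Measure E))
      (F := fun (l : ℝ) y => U y * g (l • y))
      (F' := fun (l : ℝ) y => U y * fderiv ℝ g (l • y) y) (s := Ioo (1 / 2 : ℝ) 2)
      (bound := (closedBall (0 : E) (2 * R)).indicator fun y => |U y| * (C * ‖y‖))
      (Ioo_mem_nhds (by norm_num) (by norm_num)) ?_ ?_ ?_ ?_ ?_ ?_).2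
    · exact .of_forall fun l => (hcd l).aestronglyMeasurable
    · simp only [one_smul]
      exact (hU.mul hg.continuous).integrable_of_hasCompactSupport hgs.mul_left
    · exact (hU.mul (((hg.continuous_fderiv one_ne_zero).comp
        (continuous_const_smul (1 : ℝ))).clm_apply continuous_id)).aestronglyMeasurable
    · refine .of_forall fun y l hl => ?_
      by_cases hy : y ∈ closedBall (0 : E) (2 * R)
      · rw [indicator_of_mem hy, norm_mul, Real.norm_eq_abs]
        gcongr
        exact ((fderiv ℝ g (l • y)).le_opNorm y).trans (by gcongr; exact hC _)
      · rw [indicator_of_notMem hy, fderiv_of_notMem_tsupport]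
        · simp
        · intro hmem
          have h1 := mem_closedBall_zero_iff.1 (hR hmem)
          rw [norm_smul, Real.norm_of_nonneg (by linarith [hl.1])] at h1
          rw [mem_closedBall_zero_iff] at hy
          push Not at hy
          nlinarith [hl.1, norm_nonneg y]
    · rw [integrable_indicator_iff measurableSet_closedBall]
      exact (hU.abs.mul (continuous_const.mul continuous_norm)).continuousOn.integrableOn_compact
        (isCompact_closedBall _ _)
    · refine .of_forall fun y l hl => ?_
      have hl : HasDerivAt (fun l : ℝ => l • y) y l := by
        simpa using (hasDerivAt_id l).smul_const y
      exact (((hg.differentiable one_ne_zero) (l • y)).hasFDerivAt.comp_hasDerivAt l hl).const_mul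
        (U y)
  have := hd2.unique hd1
  simpa using this

omit [FiniteDimensional ℝ E] [MeasurableSpace E] [BorelSpace E] in
lemma hessRadial_sub_right (κ : ℝ → ℝ) (ξ η ζ z : E) :
    hessRadial κ ξ (η - ζ) z = hessRadial κ ξ η z - hessRadial κ ξ ζ z := by
  simp only [hessRadial, inner_sub_right]
  ring

/-- The second derivative of a mollification at `x` in the directions `η` and `x`, for a
`1`-homogeneous solution of `Δ U = F`. The unmollified quantity vanishes by homogeneity. -/
lemma integral_hessRadial_self {F : E → ℝ} (hU : Continuous U)
    (hhom : ∀ l : ℝ, 0 < l → ∀ y, U (l • y) = l * U y)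
    (hsol : ∀ φ : E → ℝ, ContDiff ℝ ∞ φ → HasCompactSupport φ →
      ∫ y, U y * (Δ φ) y = ∫ y, F y * φ y) {κ : ℝ → ℝ} (hκ : ContDiff ℝ ∞ κ) {b : ℝ}
    (hb : ∀ ρ, b ≤ ρ → κ ρ = 0) (x η : E) :
    ∫ y, U y * hessRadial κ η x (x - y) = ∫ y, F y * (inner ℝ η (x - y) * κ (‖x - y‖ ^ 2)) := by
  have hφ : ContDiff ℝ ∞ fun y => inner ℝ η (x - y) * κ (‖x - y‖ ^ 2) :=
    (contDiff_const.inner ℝ (contDiff_const.sub contDiff_id)).mul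
      ((contDiff_radial hκ).comp (contDiff_const.sub contDiff_id))
  have hφs : HasCompactSupport fun y => inner ℝ η (x - y) * κ (‖x - y‖ ^ 2) :=
    ((hasCompactSupport_radial hb).comp_homeomorph (Homeomorph.subLeft x)).mul_left
  rw [← hsol _ hφ hφs]
  have hg : ContDiff ℝ ∞ fun y => gradRadial κ η (x - y) :=
    (contDiff_gradRadial hκ η).comp (contDiff_const.sub contDiff_id)
  have hgs : HasCompactSupport fun y => gradRadial κ η (x - y) :=
    (hasCompactSupport_gradRadial hκ hb η).comp_homeomorph (Homeomorph.subLeft x)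
  have hE := integral_mul_fderiv_self_of_homogeneous hU hhom (hg.of_le (by simp)) hgs
  have hfd : ∀ y, fderiv ℝ (fun y => gradRadial κ η (x - y)) y y
      = -hessRadial κ η y (x - y) := by
    intro y
    rw [← fderiv_gradRadial_eq hκ]
    have hgd := ((contDiff_gradRadial hκ η).differentiable (by simp)).differentiableAt
      (x := x - y) |>.hasFDerivAt
    have hsub : HasFDerivAt (fun y : E => x - y) (-ContinuousLinearMap.id ℝ E) y :=
      (hasFDerivAt_id y).const_sub x
    rw [show fderiv ℝ (fun y => gradRadial κ η (x - y)) y = _ from (hgd.comp y hsub).fderiv]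
    simp
  simp only [hfd, mul_neg, integral_neg, neg_inj] at hE
  set N := Module.finrank ℝ E with hN
  have hlap : ∀ y, (Δ fun y => inner ℝ η (x - y) * κ (‖x - y‖ ^ 2)) y
      = hessRadial κ η x (x - y) - hessRadial κ η y (x - y)
        + (N + 1) * gradRadial κ η (x - y) := by
    intro y
    have h1 := laplacian_affine_mul_radial (M := κ) (contDiff_infty.1 hκ 2) 0 η x y
    simp only [zero_add] at h1
    rw [h1, ← hessRadial_sub_right, hessRadial, gradRadial, ← hN, real_inner_self_eq_norm_sq,
      real_inner_comm]
    ring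
  have i1 : Integrable fun y => U y * hessRadial κ η x (x - y) :=
    integrable_mul_comp_sub hU.locallyIntegrable (contDiff_hessRadial hκ η x).continuous
      (hasCompactSupport_hessRadial hκ hb η x) x
  have i2 : Integrable fun y => U y * gradRadial κ η (x - y) :=
    integrable_mul_comp_sub hU.locallyIntegrable (contDiff_gradRadial hκ η).continuous
      (hasCompactSupport_gradRadial hκ hb η) x
  have i3 : Integrable fun y => U y * hessRadial κ η y (x - y) := by
    refine Continuous.integrable_of_hasCompactSupport (hU.mul ?_) ?_
    · have e : (fun y => hessRadial κ η y (x - y))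
          = fun y => -fderiv ℝ (fun y => gradRadial κ η (x - y)) y y := by
        ext y; rw [hfd, neg_neg]
      rw [e]
      exact ((hg.continuous_fderiv (by simp)).clm_apply continuous_id).neg
    · have e : (fun y => U y * hessRadial κ η y (x - y))
          = fun y => -(U y) * fderiv ℝ (fun y => gradRadial κ η (x - y)) y y := by
        ext y; rw [hfd]; ring
      rw [e]
      refine HasCompactSupport.mul_left ?_
      refine (hgs.fderiv ℝ).mono fun y hy => ?_
      rw [Function.mem_support] at hy ⊢
      intro h
      exact hy (by rw [h]; simp)
  have e : ∀ y, U y * (Δ fun y => inner ℝ η (x - y) * κ (‖x - y‖ ^ 2)) y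
      = U y * hessRadial κ η x (x - y) - U y * hessRadial κ η y (x - y)
        + (N + 1) * (U y * gradRadial κ η (x - y)) := by
    intro y
    rw [hlap]
    ring
  simp only [e]
  have i13 : Integrable fun y => U y * hessRadial κ η x (x - y) - U y * hessRadial κ η y (x - y) :=
    i1.sub i3
  rw [integral_add i13 (i2.const_mul _), integral_sub i1 i3, integral_const_mul, hE]
  ring

lemma integral_mollProfile_pos (hd : 1 ≤ Module.finrank ℝ E) (N : ℕ) :
    0 < ∫ z : E, mollProfile N (‖z‖ ^ 2) := by
  have : Nontrivial E := Module.nontrivial_of_finrank_pos (R := ℝ) hd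
  obtain ⟨r, hr, hne⟩ := exists_mollProfile_ne_zero N
  obtain ⟨z, hz⟩ := exists_norm_eq E hr.le
  refine Continuous.integral_pos_of_hasCompactSupport_nonneg_nonzero (x := z)
    (contDiff_radial (contDiff_mollProfile N)).continuous
    (hasCompactSupport_radial fun ρ hρ => mollProfile_of_three_le N hρ)
    (fun z => mollProfile_nonneg N _) ?_
  rwa [hz]

omit [FiniteDimensional ℝ E] [MeasurableSpace E] [BorelSpace E] in
lemma scaleProfile_norm_sq (N : ℕ) (h : ℝ → ℝ) {s : ℝ} (hs : 0 < s) (z : E) :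
    scaleProfile N h s (‖z‖ ^ 2) = (s ^ N)⁻¹ * h (‖s⁻¹ • z‖ ^ 2) := by
  rw [scaleProfile, norm_smul, norm_inv, Real.norm_of_nonneg hs.le, mul_pow, inv_pow]
  congr 2
  field_simp

lemma integral_mul_scaleProfile (A : E → ℝ) {s : ℝ} (hs : 0 < s) (h : ℝ → ℝ) (x : E) :
    ∫ y, A y * scaleProfile (Module.finrank ℝ E) h s (‖x - y‖ ^ 2)
      = ∫ z, A (x - s • z) * h (‖z‖ ^ 2) := by
  have h1 := integral_mul_comp_inv_smul_sub A (fun z => h (‖z‖ ^ 2)) hs x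
  have h2 : ∀ y, A y * scaleProfile (Module.finrank ℝ E) h s (‖x - y‖ ^ 2)
      = (s ^ Module.finrank ℝ E)⁻¹ * (A y * h (‖s⁻¹ • (x - y)‖ ^ 2)) := by
    intro y
    rw [scaleProfile_norm_sq _ h hs]
    ring
  simp only [h2]
  rw [integral_const_mul, h1]
  field_simp

/-- The second derivatives of the mollifications at `x` in the directions `η` and `x` tend to zero
with the scale `s`. -/
lemma exists_abs_integral_hessRadial_self_le (hc : 0 < c) (hlow : ∀ y, c * ‖y‖ ≤ G y)
    (hU : Continuous U)
    (hhom : ∀ l : ℝ, 0 < l → ∀ y, U (l • y) = l * U y)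
    (hsol : ∀ φ : E → ℝ, ContDiff ℝ ∞ φ → HasCompactSupport φ →
      ∫ y, U y * (Δ φ) y = ∫ y, (G y)⁻¹ * φ y) :
    ∃ K, 0 ≤ K ∧ ∀ (r s : ℝ) (x η : E), 0 < r → r ≤ ‖x‖ → 0 < s → 4 * s ≤ r →
      |∫ y, U y * hessRadial (scaleProfile (Module.finrank ℝ E)
        (mollProfile (Module.finrank ℝ E)) s) η x (x - y)| ≤ K * s * ‖η‖ / r := by
  set N := Module.finrank ℝ E with hN
  set k0 := ∫ z : E, mollProfile N (‖z‖ ^ 2) with hk0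
  have hk0nn : 0 ≤ k0 := integral_nonneg fun z => mollProfile_nonneg N _
  refine ⟨4 * c⁻¹ * k0, by positivity, ?_⟩
  intro r s x η hr hrx hs hsr
  rw [integral_hessRadial_self hU hhom hsol (contDiff_scaleProfile N (contDiff_mollProfile N) s)
    (fun ρ hρ => scaleProfile_mollProfile_of_le N hs hρ) x η]
  have hi : Integrable fun y => (4 * c⁻¹ * s * ‖η‖ / r) *
      scaleProfile N (mollProfile N) s (‖x - y‖ ^ 2) :=
    integrable_mul_comp_sub (g := fun z => scaleProfile N (mollProfile N) s (‖z‖ ^ 2))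
      (locallyIntegrable_const _)
      (contDiff_radial (contDiff_scaleProfile N (contDiff_mollProfile N) s)).continuous
      (hasCompactSupport_radial fun ρ hρ => scaleProfile_mollProfile_of_le N hs hρ) x
  have hval : ∫ y, (4 * c⁻¹ * s * ‖η‖ / r) * scaleProfile N (mollProfile N) s (‖x - y‖ ^ 2)
      = 4 * c⁻¹ * k0 * s * ‖η‖ / r := by
    rw [hN, integral_mul_scaleProfile (fun _ => 4 * c⁻¹ * s * ‖η‖ / r) hs, integral_const_mul]
    ring
  rw [← hval, ← Real.norm_eq_abs]
  refine norm_integral_le_of_norm_le hi (.of_forall fun y => ?_)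
  rw [norm_mul, norm_mul, Real.norm_eq_abs, Real.norm_eq_abs, Real.norm_eq_abs]
  have hnn : 0 ≤ scaleProfile N (mollProfile N) s (‖x - y‖ ^ 2) :=
    mul_nonneg (by positivity) (mollProfile_nonneg N _)
  by_cases hxy : ‖x - y‖ ≤ 2 * s
  · have hyr : r / 2 ≤ ‖y‖ := by
      have := norm_sub_norm_le x (x - y)
      rw [sub_sub_cancel] at this
      linarith
    have hy : y ≠ 0 := norm_pos_iff.1 (by linarith)
    rw [abs_of_nonneg hnn, ← mul_assoc]
    gcongr
    calc |(G y)⁻¹| * |inner ℝ η (x - y)| ≤ (c⁻¹ * ‖y‖⁻¹) * (‖η‖ * ‖x - y‖) := by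
          gcongr
          · exact inv_le_of_mul_norm_le hc hlow hy
          · exact abs_real_inner_le_norm _ _
      _ ≤ (c⁻¹ * (r / 2)⁻¹) * (‖η‖ * (2 * s)) := by gcongr
      _ = _ := by field_simp; ring
  · push Not at hxy
    have : scaleProfile N (mollProfile N) s (‖x - y‖ ^ 2) = 0 :=
      scaleProfile_mollProfile_of_le N hs (by nlinarith)
    rw [this]
    simp

end Euler

/-! ### Convexity of homogeneous solutions -/

section Convexity

variable {E : Type*} [NormedAddCommGroup E] [InnerProductSpace ℝ E] [FiniteDimensional ℝ E]
  [MeasurableSpace E] [BorelSpace E] {G U : E → ℝ} {L : NNReal} {c B : ℝ}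

/-- The mollification of `U` at scale `s`. The mollifier is nonnegative, but its integral is not
normalized. -/
def mollify (U : E → ℝ) (s : ℝ) (x : E) : ℝ :=
  ∫ y, U y * scaleProfile (Module.finrank ℝ E) (mollProfile (Module.finrank ℝ E)) s (‖x - y‖ ^ 2)

/-- The second derivative of `mollify U s` at `x` in the directions `ξ` and `η`. -/
def hessMollify (U : E → ℝ) (s : ℝ) (ξ η x : E) : ℝ :=
  ∫ y, U y * hessRadial (scaleProfile (Module.finrank ℝ E)
    (mollProfile (Module.finrank ℝ E)) s) ξ η (x - y)

/-- The singular integral which is, up to a constant factor, the second derivative at `x` in the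
direction `ξ` of a solution of `Δ U = G⁻¹`. -/
def singularHess (G : E → ℝ) (x ξ : E) : ℝ :=
  ∫ y, fderiv ℝ (fun z => (G z)⁻¹) y ξ * (inner ℝ (x - y) ξ *
    (‖x - y‖ ^ Module.finrank ℝ E)⁻¹)

lemma exists_hasDerivAt_mollify (hU : Continuous U) {s : ℝ} (hs : 0 < s) (x ξ : E) :
    ∃ g : ℝ → ℝ, (∀ t, HasDerivAt (fun t : ℝ => mollify U s (x + t • ξ)) (g t) t) ∧
      ∀ t, HasDerivAt g (hessMollify U s ξ ξ (x + t • ξ)) t :=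
  ⟨_, hasDerivAt_integral_radial hU.locallyIntegrable
      (contDiff_scaleProfile _ (contDiff_mollProfile _) s)
      (fun _ hρ => scaleProfile_mollProfile_of_le _ hs hρ) x ξ,
    hasDerivAt_integral_gradRadial hU.locallyIntegrable
      (contDiff_scaleProfile _ (contDiff_mollProfile _) s)
      (fun _ hρ => scaleProfile_mollProfile_of_le _ hs hρ) x ξ ξ⟩

lemma mollify_eq {s : ℝ} (hs : 0 < s) (x : E) :
    mollify U s x = ∫ z, U (x - s • z) * mollProfile (Module.finrank ℝ E) (‖z‖ ^ 2) :=
  integral_mul_scaleProfile U hs _ x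

lemma integrable_mul_mollProfile {V : E → ℝ} (hV : Continuous V) (N : ℕ) :
    Integrable fun z : E => V z * mollProfile N (‖z‖ ^ 2) :=
  LocallyIntegrable.integrable_mul_of_hasCompactSupport hV.locallyIntegrable
    (contDiff_radial (contDiff_mollProfile N)).continuous
    (hasCompactSupport_radial fun _ hρ => mollProfile_of_three_le N hρ)

lemma tendsto_mollify (hU : Continuous U) (hB0 : 0 ≤ B) (hB : ∀ y, |U y| ≤ B * ‖y‖) (x : E) :
    Tendsto (fun s => mollify U s x) (𝓝[>] 0)
      (𝓝 (U x * ∫ z : E, mollProfile (Module.finrank ℝ E) (‖z‖ ^ 2))) := by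
  set N := Module.finrank ℝ E with hN
  have h : Tendsto (fun s : ℝ => ∫ z, U (x - s • z) * mollProfile N (‖z‖ ^ 2)) (𝓝[>] 0)
      (𝓝 (∫ z : E, U x * mollProfile N (‖z‖ ^ 2))) := by
    refine tendsto_integral_filter_of_dominated_convergence
      (fun z => (B * (‖x‖ + ‖z‖)) * mollProfile N (‖z‖ ^ 2)) ?_ ?_ ?_ ?_
    · refine .of_forall fun s => ?_
      exact (integrable_mul_mollProfile (hU.comp (by fun_prop)) N).aestronglyMeasurable
    · filter_upwards [Ioo_mem_nhdsGT (zero_lt_one (α := ℝ))] with s hs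
      refine .of_forall fun z => ?_
      rw [norm_mul, Real.norm_eq_abs, Real.norm_eq_abs, abs_of_nonneg (mollProfile_nonneg N _)]
      have := mollProfile_nonneg N (‖z‖ ^ 2)
      gcongr
      refine (hB _).trans ?_
      gcongr
      refine (norm_sub_le _ _).trans ?_
      rw [norm_smul, Real.norm_of_nonneg hs.1.le]
      have := mul_le_of_le_one_left (norm_nonneg z) hs.2.le
      linarith
    · exact integrable_mul_mollProfile (by fun_prop) N
    · refine .of_forall fun z => Tendsto.mul_const _ ?_
      have : Continuous fun s : ℝ => U (x - s • z) := hU.comp (by fun_prop)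
      have h2 := (this.tendsto 0).mono_left (nhdsWithin_le_nhds (s := Ioi 0))
      simpa using h2
  rw [integral_const_mul] at h
  refine h.congr' ?_
  filter_upwards [self_mem_nhdsWithin] with s hs
  exact (mollify_eq hs x).symm

lemma convexOn_mollify (hU : Continuous U) (hconv : ConvexOn ℝ univ U) {s : ℝ} (hs : 0 < s) :
    ConvexOn ℝ univ (mollify U s) := by
  refine ⟨convex_univ, fun x _ y _ a b ha hb hab => ?_⟩
  have hi : ∀ x, Integrable fun z : E => U (x - s • z) *
      mollProfile (Module.finrank ℝ E) (‖z‖ ^ 2) := fun x =>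
    integrable_mul_mollProfile (hU.comp (by fun_prop)) _
  rw [mollify_eq hs, mollify_eq hs, mollify_eq hs, smul_eq_mul, smul_eq_mul,
    ← integral_const_mul, ← integral_const_mul,
    ← integral_add ((hi x).const_mul a) ((hi y).const_mul b)]
  refine integral_mono (hi _) (((hi x).const_mul a).add ((hi y).const_mul b)) fun z => ?_
  have h1 := hconv.2 (mem_univ (x - s • z)) (mem_univ (y - s • z)) ha hb hab
  have h2 : a • x + b • y - s • z = a • (x - s • z) + b • (y - s • z) := by
    rw [smul_sub, smul_sub, sub_add_sub_comm, ← add_smul, hab, one_smul]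
  change _ ≤ _ * (_ * _) + _ * (_ * _)
  rw [h2, ← mul_assoc, ← mul_assoc, ← add_mul]
  exact mul_le_mul_of_nonneg_right h1 (mollProfile_nonneg _ _)

lemma hessMollify_nonneg_of_convexOn (hU : Continuous U) (hconv : ConvexOn ℝ univ U) {s : ℝ}
    (hs : 0 < s) (x ξ : E) : 0 ≤ hessMollify U s ξ ξ x := by
  obtain ⟨g, hg, hg'⟩ := exists_hasDerivAt_mollify hU hs x ξ
  have h1 : ConvexOn ℝ univ fun t : ℝ => mollify U s (x + t • ξ) := by
    have := (convexOn_mollify hU hconv hs).comp_affineMap (AffineMap.lineMap x (x + ξ))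
    refine this.congr fun t _ => ?_
    simp [AffineMap.lineMap_apply, add_comm]
  have h2 : Monotone g := by
    have h3 := h1.monotoneOn_deriv fun t _ => (hg t).differentiableAt
    rw [monotoneOn_univ] at h3
    rwa [show deriv (fun t : ℝ => mollify U s (x + t • ξ)) = g from
      funext fun t => (hg t).deriv] at h3
  have h4 := h2.deriv_nonneg (x := 0)
  rw [(hg' 0).deriv] at h4
  simpa using h4

/-- Subtracting from `ξ` a multiple of `x` changes the second derivative at `x` only by a second
derivative with one of its directions equal to `x`. -/
lemma hessMollify_self_eq (hU : Continuous U) {s : ℝ} (hs : 0 < s) (x ξ : E) (a : ℝ) :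
    hessMollify U s ξ ξ x = hessMollify U s (ξ - a • x) (ξ - a • x) x
      + a * hessMollify U s (ξ + (ξ - a • x)) x x := by
  have hi : ∀ ξ η, Integrable fun y => U y * hessRadial (scaleProfile (Module.finrank ℝ E)
      (mollProfile (Module.finrank ℝ E)) s) ξ η (x - y) := fun ξ η =>
    integrable_mul_comp_sub hU.locallyIntegrable
      (contDiff_hessRadial (contDiff_scaleProfile _ (contDiff_mollProfile _) s) ξ η).continuous
      (hasCompactSupport_hessRadial (contDiff_scaleProfile _ (contDiff_mollProfile _) s)
        (fun _ hρ => scaleProfile_mollProfile_of_le _ hs hρ) ξ η) x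
  rw [hessMollify, hessMollify, hessMollify, ← integral_const_mul,
    ← integral_add (hi _ _) ((hi _ _).const_mul a)]
  congr 1
  ext y
  simp only [hessRadial, inner_sub_left, inner_sub_right, inner_add_left, inner_add_right,
    inner_smul_left, inner_smul_right, conj_trivial]
  rw [real_inner_comm x ξ]
  ring

/-- If the singular integral is nonnegative in the directions orthogonal to the position vector,
then the mollified second derivatives have a lower bound tending to zero with the scale, in all
directions. -/
lemma exists_le_hessMollify (hG : LipschitzWith L G) (hc : 0 < c)
    (hlow : ∀ y, c * ‖y‖ ≤ G y) (hd : 3 ≤ Module.finrank ℝ E) (hU : Continuous U) (hB0 : 0 ≤ B)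
    (hB : ∀ y, |U y| ≤ B * ‖y‖) (hhom : ∀ l : ℝ, 0 < l → ∀ y, U (l • y) = l * U y)
    (hsol : ∀ φ : E → ℝ, ContDiff ℝ ∞ φ → HasCompactSupport φ →
      ∫ y, U y * (Δ φ) y = ∫ y, (G y)⁻¹ * φ y)
    (hV : ∀ x ξ : E, x ≠ 0 → inner ℝ ξ x = 0 → 0 ≤ singularHess G x ξ) :
    ∃ K, 0 ≤ K ∧ ∀ (r s : ℝ) (x ξ : E), 0 < r → r ≤ ‖x‖ → 0 < s → 4 * s ≤ r →
      -(K * s * ‖ξ‖ ^ 2 / r ^ 2) ≤ hessMollify U s ξ ξ x := by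
  obtain ⟨K, hK0, hK⟩ := exists_abs_integral_hessRadial_sub_le hG hc hlow hd hU hB0 hB hsol
  obtain ⟨K', hK0', hK'⟩ := exists_abs_integral_hessRadial_self_le hc hlow hU hhom hsol
  refine ⟨K + 2 * K', by positivity, ?_⟩
  intro r s x ξ hr hrx hs hsr
  have hxpos : 0 < ‖x‖ := hr.trans_le hrx
  set a : ℝ := inner ℝ x ξ / ‖x‖ ^ 2 with ha
  set η := ξ - a • x with hη
  have hηx : inner ℝ η x = 0 := by
    rw [hη, inner_sub_left, inner_smul_left, real_inner_self_eq_norm_sq, conj_trivial, ha,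
      div_mul_cancel₀ _ (by positivity), real_inner_comm, sub_self]
  have hηξ : ‖η‖ ≤ ‖ξ‖ := by
    have h1 : ‖ξ‖ ^ 2 = ‖η‖ ^ 2 + ‖a • x‖ ^ 2 := by
      have h2 := norm_add_sq_real η (a • x)
      rw [inner_smul_right, hηx, hη, sub_add_cancel] at h2
      rw [h2]; ring
    refine le_of_sq_le_sq ?_ (norm_nonneg ξ)
    linarith [sq_nonneg ‖a • x‖]
  have haξ : |a| ≤ ‖ξ‖ / r := by
    rw [ha, abs_div, abs_of_pos (by positivity : 0 < ‖x‖ ^ 2), div_le_div_iff₀ (by positivity) hr]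
    calc |inner ℝ x ξ| * r ≤ (‖x‖ * ‖ξ‖) * ‖x‖ := by
          gcongr
          exact abs_real_inner_le_norm x ξ
      _ = _ := by ring
  have h1 := hK r s x η hr hrx hs hsr
  have h2 := hK' r s x (ξ + η) hr hrx hs hsr
  have h3 : 0 ≤ singularHess G x η := hV x η (norm_pos_iff.1 hxpos) hηx
  have h4 : -(K * s * ‖ξ‖ ^ 2 / r ^ 2) ≤ hessMollify U s η η x := by
    have h5 := (abs_le.1 h1).1
    have h6 : K * s * ‖η‖ ^ 2 / r ^ 2 ≤ K * s * ‖ξ‖ ^ 2 / r ^ 2 := by gcongr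
    rw [singularHess] at h3
    rw [hessMollify]
    linarith
  have h7 : |a * hessMollify U s (ξ + η) x x| ≤ 2 * K' * s * ‖ξ‖ ^ 2 / r ^ 2 := by
    rw [abs_mul]
    calc |a| * |hessMollify U s (ξ + η) x x| ≤ (‖ξ‖ / r) * (K' * s * (‖ξ‖ + ‖ξ‖) / r) := by
          refine mul_le_mul haξ (h2.trans ?_) (abs_nonneg _) (by positivity)
          gcongr
          exact (norm_add_le _ _).trans (by gcongr)
      _ = _ := by field_simp; ring
  rw [hessMollify_self_eq hU hs x ξ a, ← hη]
  have h8 := (abs_le.1 h7).1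
  have h9 : (K + 2 * K') * s * ‖ξ‖ ^ 2 / r ^ 2
      = K * s * ‖ξ‖ ^ 2 / r ^ 2 + 2 * K' * s * ‖ξ‖ ^ 2 / r ^ 2 := by ring
  linarith

/-- Convexity along a segment at positive distance from the origin. -/
lemma le_of_segment_away_from_zero (hU : Continuous U) (hd : 1 ≤ Module.finrank ℝ E) (hB0 : 0 ≤ B)
    (hB : ∀ y, |U y| ≤ B * ‖y‖) {K : ℝ}
    (hK : ∀ (r s : ℝ) (x ξ : E), 0 < r → r ≤ ‖x‖ → 0 < s → 4 * s ≤ r →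
      -(K * s * ‖ξ‖ ^ 2 / r ^ 2) ≤ hessMollify U s ξ ξ x)
    {x y : E} {p q r : ℝ} (hp : 0 ≤ p) (hq : 0 ≤ q) (hpq : p + q = 1) (hr : 0 < r)
    (hseg : ∀ t ∈ Icc (0 : ℝ) 1, r ≤ ‖x + t • (y - x)‖) :
    U (p • x + q • y) ≤ p * U x + q * U y := by
  set ξ := y - x with hξ
  set D : ℝ → ℝ := fun s => K * s * ‖ξ‖ ^ 2 / r ^ 2 with hD
  have hpq' : p • x + q • y = x + q • ξ := by
    rw [hξ, smul_sub, show p = 1 - q by linarith, sub_smul, one_smul]; abel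
  have key : ∀ᶠ s in 𝓝[>] (0 : ℝ),
      mollify U s (p • x + q • y) + D s / 2 * q ^ 2
        ≤ p * mollify U s x + q * (mollify U s y + D s / 2) := by
    filter_upwards [Ioo_mem_nhdsGT (show (0 : ℝ) < r / 4 by positivity)] with s hs
    obtain ⟨g, hg, hg'⟩ := exists_hasDerivAt_mollify hU hs.1 x ξ
    have hconv : ConvexOn ℝ (Icc (0 : ℝ) 1)
        fun t : ℝ => mollify U s (x + t • ξ) + D s / 2 * t ^ 2 := by
      have h1 : ∀ t, HasDerivAt (fun t : ℝ => mollify U s (x + t • ξ) + D s / 2 * t ^ 2)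
          (g t + D s * t) t := by
        intro t
        have := (hg t).add ((hasDerivAt_pow 2 t).const_mul (D s / 2))
        refine this.congr_deriv ?_
        push_cast
        ring
      have h2 : ∀ t, HasDerivAt (fun t : ℝ => g t + D s * t)
          (hessMollify U s ξ ξ (x + t • ξ) + D s) t := by
        intro t
        have := (hg' t).add ((hasDerivAt_id t).const_mul (D s))
        refine this.congr_deriv ?_
        ring
      refine convexOn_of_hasDerivWithinAt2_nonneg (convex_Icc 0 1)
        (fun t _ => (h1 t).continuousAt.continuousWithinAt)
        (fun t _ => (h1 t).hasDerivWithinAt) (fun t _ => (h2 t).hasDerivWithinAt) ?_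
      intro t ht
      have := hK r s (x + t • ξ) ξ hr (hseg t (interior_subset ht)) hs.1 (by linarith [hs.2])
      simp only [hD]
      linarith
    have h := hconv.2 (left_mem_Icc.2 zero_le_one) (right_mem_Icc.2 zero_le_one) hp hq hpq
    simp only [smul_eq_mul, mul_zero, zero_add, mul_one, zero_smul, add_zero, one_smul, one_pow,
      ne_eq, OfNat.ofNat_ne_zero, not_false_eq_true, zero_pow] at h
    rw [hpq']
    rw [hξ, add_sub_cancel] at h
    rwa [hξ]
  have hDlim : Tendsto D (𝓝[>] 0) (𝓝 0) := by
    have : Continuous D := by fun_prop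
    have h2 := (this.tendsto 0).mono_left (nhdsWithin_le_nhds (s := Ioi 0))
    simpa [hD] using h2
  set k0 := ∫ z : E, mollProfile (Module.finrank ℝ E) (‖z‖ ^ 2) with hk0
  have hk0pos : 0 < k0 := integral_mollProfile_pos hd _
  have hlim := le_of_tendsto_of_tendsto
    ((tendsto_mollify hU hB0 hB (p • x + q • y)).add ((hDlim.div_const 2).mul_const (q ^ 2)))
    (((tendsto_mollify hU hB0 hB x).const_mul p).add
      (((tendsto_mollify hU hB0 hB y).add (hDlim.div_const 2)).const_mul q)) key
  rw [← hk0] at hlim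
  simp only [zero_div, zero_mul, add_zero] at hlim
  refine le_of_mul_le_mul_right ?_ hk0pos
  linarith

/-- A `1`-homogeneous solution of `Δ U = G⁻¹` is convex if and only if the singular integral is
nonnegative in the directions orthogonal to the position vector. -/
lemma convexOn_iff_singularHess_nonneg (hG : LipschitzWith L G) (hc : 0 < c)
    (hlow : ∀ y, c * ‖y‖ ≤ G y) (hd : 3 ≤ Module.finrank ℝ E) (hU : Continuous U) (hB0 : 0 ≤ B)
    (hB : ∀ y, |U y| ≤ B * ‖y‖) (hhom : ∀ l : ℝ, 0 < l → ∀ y, U (l • y) = l * U y)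
    (hsol : ∀ φ : E → ℝ, ContDiff ℝ ∞ φ → HasCompactSupport φ →
      ∫ y, U y * (Δ φ) y = ∫ y, (G y)⁻¹ * φ y) :
    ConvexOn ℝ univ U ↔ ∀ x ξ : E, x ≠ 0 → inner ℝ ξ x = 0 → 0 ≤ singularHess G x ξ := by
  constructor
  · intro hconv x ξ hx _
    obtain ⟨K, hK0, hK⟩ := exists_abs_integral_hessRadial_sub_le hG hc hlow hd hU hB0 hB hsol
    have hxpos := norm_pos_iff.2 hx
    have hlim : Tendsto (fun s : ℝ => -(K * s * ‖ξ‖ ^ 2 / ‖x‖ ^ 2)) (𝓝[>] 0) (𝓝 0) := by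
      have : Continuous fun s : ℝ => -(K * s * ‖ξ‖ ^ 2 / ‖x‖ ^ 2) := by fun_prop
      have h2 := (this.tendsto 0).mono_left (nhdsWithin_le_nhds (s := Ioi 0))
      simpa using h2
    refine le_of_tendsto hlim ?_
    filter_upwards [Ioo_mem_nhdsGT (show (0 : ℝ) < ‖x‖ / 4 by positivity)] with s hs
    have h1 := (abs_le.1 (hK ‖x‖ s x ξ hxpos le_rfl hs.1 (by linarith [hs.2]))).2
    have h2 := hessMollify_nonneg_of_convexOn hU hconv hs.1 x ξ
    rw [hessMollify] at h2
    rw [singularHess]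
    linarith
  · intro hV
    obtain ⟨K, hK0, hK⟩ := exists_le_hessMollify hG hc hlow hd hU hB0 hB hhom hsol hV
    refine ⟨convex_univ, fun x _ y _ p q hp hq hpq => ?_⟩
    -- A vector orthogonal to the segment, used to shift it away from the origin.
    obtain ⟨w, hw, hw0⟩ : ∃ w ∈ (Submodule.span ℝ {x, y})ᗮ, w ≠ 0 := by
      refine Submodule.exists_mem_ne_zero_of_ne_bot fun hbot => ?_
      have h1 := Submodule.finrank_add_finrank_orthogonal (Submodule.span ℝ {x, y})
      have h2 : Module.finrank ℝ (Submodule.span ℝ {x, y}) ≤ 2 := by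
        classical
        have := finrank_span_finset_le_card (R := ℝ) ({x, y} : Finset E)
        rw [Finset.coe_pair] at this
        exact this.trans Finset.card_le_two
      rw [hbot, finrank_bot] at h1
      lia
    have hwpos := norm_pos_iff.2 hw0
    have hwx : inner ℝ x w = 0 := hw x (Submodule.subset_span (by simp))
    have hwy : inner ℝ y w = 0 := hw y (Submodule.subset_span (by simp))
    have hshift : ∀ τ : ℝ, 0 < τ → U (p • (x + τ • w) + q • (y + τ • w))
        ≤ p * U (x + τ • w) + q * U (y + τ • w) := by
      intro τ hτ
      refine le_of_segment_away_from_zero hU (by lia) hB0 hB hK hp hq hpq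
        (r := τ * ‖w‖) (by positivity) fun t _ => ?_
      have e1 : x + τ • w + t • (y + τ • w - (x + τ • w)) = (x + t • (y - x)) + τ • w := by
        rw [add_sub_add_right_eq_sub]; abel
      have e2 : inner ℝ (x + t • (y - x)) (τ • w) = 0 := by
        rw [inner_smul_right, inner_add_left, inner_smul_left, inner_sub_left, hwx, hwy]
        simp
      rw [e1]
      refine le_of_sq_le_sq ?_ (norm_nonneg _)
      rw [norm_add_sq_real, e2, norm_smul, Real.norm_of_nonneg hτ.le]
      nlinarith [sq_nonneg ‖x + t • (y - x)‖]
    have hc1 : Continuous fun τ : ℝ => U (p • (x + τ • w) + q • (y + τ • w)) :=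
      hU.comp (by fun_prop)
    have hc2 : Continuous fun τ : ℝ => p * U (x + τ • w) + q * U (y + τ • w) :=
      (continuous_const.mul (hU.comp (by fun_prop))).add
        (continuous_const.mul (hU.comp (by fun_prop)))
    have hlim := le_of_tendsto_of_tendsto
      ((hc1.tendsto 0).mono_left (nhdsWithin_le_nhds (s := Ioi 0)))
      ((hc2.tendsto 0).mono_left (nhdsWithin_le_nhds (s := Ioi 0)))
      (by filter_upwards [self_mem_nhdsWithin] with τ hτ; exact hshift τ hτ)
    simpa using hlim

/-- The singular integral is homogeneous in both arguments; nonnegativity may be tested on unit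
vectors. -/
lemma singularHess_nonneg_of_unit (hhom : ∀ l : ℝ, 0 < l → ∀ y, G (l • y) = l * G y)
    (h : ∀ x ξ : E, ‖x‖ = 1 → ‖ξ‖ = 1 → inner ℝ ξ x = 0 → 0 ≤ singularHess G x ξ)
    {x ξ : E} (hx : x ≠ 0) (hξx : inner ℝ ξ x = 0) : 0 ≤ singularHess G x ξ := by
  by_cases hξ : ξ = 0
  · simp [singularHess, hξ]
  have hxp := norm_pos_iff.2 hx
  have hξp := norm_pos_iff.2 hξ
  set N := Module.finrank ℝ E with hN
  set e := ‖x‖⁻¹ • x with he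
  set ζ := ‖ξ‖⁻¹ • ξ with hζ
  have hxe : x = ‖x‖ • e := by rw [he, smul_smul, mul_inv_cancel₀ hxp.ne', one_smul]
  have hξζ : ξ = ‖ξ‖ • ζ := by rw [hζ, smul_smul, mul_inv_cancel₀ hξp.ne', one_smul]
  have h1 : 0 ≤ singularHess G e ζ := by
    apply h
    · rw [he, norm_smul, norm_inv, norm_norm, inv_mul_cancel₀ hxp.ne']
    · rw [hζ, norm_smul, norm_inv, norm_norm, inv_mul_cancel₀ hξp.ne']
    · rw [he, hζ, inner_smul_left, inner_smul_right, hξx]; simp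
  have hfd : ∀ y v, fderiv ℝ (fun z => (G z)⁻¹) (‖x‖ • y) v
      = (‖x‖ ^ 2)⁻¹ * fderiv ℝ (fun z => (G z)⁻¹) y v := by
    intro y v
    have e1 : (fun z => (G (‖x‖ • z))⁻¹) = fun z => ‖x‖⁻¹ • (G z)⁻¹ := by
      ext z; rw [hhom _ hxp, mul_inv, smul_eq_mul]
    have e2 := fderiv_comp_smul (𝕜 := ℝ) (f := fun z => (G z)⁻¹) (x := y) ‖x‖
    have e3 : fderiv ℝ (fun z => ‖x‖⁻¹ • (G z)⁻¹) y = ‖x‖⁻¹ • fderiv ℝ (fun z => (G z)⁻¹) y :=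
      congrFun (fderiv_const_smul_field (𝕜 := ℝ) (f := fun z => (G z)⁻¹) ‖x‖⁻¹) y
    rw [e1, e3] at e2
    have e4 := congrArg (fun T => T v) e2
    simp only [_root_.smul_apply, smul_eq_mul] at e4
    field_simp at e4 ⊢
    linarith
  have h2 := Measure.integral_comp_smul (volume : Measure E) (fun y =>
    fderiv ℝ (fun z => (G z)⁻¹) y ξ * (inner ℝ (x - y) ξ * (‖x - y‖ ^ N)⁻¹)) ‖x‖
  have h3 : ∀ y, fderiv ℝ (fun z => (G z)⁻¹) (‖x‖ • y) ξ *
      (inner ℝ (x - ‖x‖ • y) ξ * (‖x - ‖x‖ • y‖ ^ N)⁻¹)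
      = ((‖x‖ ^ 2)⁻¹ * ‖ξ‖ ^ 2 * ‖x‖ * (‖x‖ ^ N)⁻¹) *
        (fderiv ℝ (fun z => (G z)⁻¹) y ζ * (inner ℝ (e - y) ζ * (‖e - y‖ ^ N)⁻¹)) := by
    intro y
    have e1 : x - ‖x‖ • y = ‖x‖ • (e - y) := by rw [smul_sub, ← hxe]
    have e2 : fderiv ℝ (fun z => (G z)⁻¹) y ξ = ‖ξ‖ * fderiv ℝ (fun z => (G z)⁻¹) y ζ := by
      rw [← smul_eq_mul, ← map_smul, ← hξζ]
    have e3 : inner ℝ (‖x‖ • (e - y)) ξ = ‖x‖ * (‖ξ‖ * inner ℝ (e - y) ζ) := by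
      rw [inner_smul_left, conj_trivial, ← inner_smul_right (e - y) ζ, ← hξζ]
    rw [hfd, e1, e2, e3, norm_smul, norm_norm, mul_pow, mul_inv]
    ring
  simp only [h3] at h2
  rw [integral_const_mul, smul_eq_mul] at h2
  have h4 : |(‖x‖ ^ N)⁻¹| * singularHess G x ξ
      = ((‖x‖ ^ 2)⁻¹ * ‖ξ‖ ^ 2 * ‖x‖ * (‖x‖ ^ N)⁻¹) * singularHess G e ζ := h2.symm
  have h5 : 0 ≤ |(‖x‖ ^ N)⁻¹| * singularHess G x ξ := by
    rw [h4]; positivity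
  exact nonneg_of_mul_nonneg_right h5 (by positivity)

end Convexity

/-! ### Polar coordinates and the spherical Laplacian -/

section Polar

variable {n : ℕ}

lemma norm_coe_sph (z : UnitSph n) : ‖(z : EucSp n)‖ = 1 := norm_eq_of_mem_sphere z

lemma coe_sph_ne_zero (z : UnitSph n) : (z : EucSp n) ≠ 0 := by
  intro h
  have := norm_coe_sph z
  rw [h] at this
  simp at this

/-- The Laplacian in polar coordinates. Along the line `t ↦ z + t e`, the extension constant on rays
of `w ↦ φ(r w)` is `φ` composed with an explicit curve on the sphere of radius `r`. Summing the
second derivatives over an orthonormal basis gives the formula. -/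
lemma sphLaplacian_eq {φ : EucSp n → ℝ} (hφ : ContDiff ℝ ∞ φ) (r : ℝ) (z : UnitSph n) :
    sphLaplacian (fun w : UnitSph n => φ (r • (w : EucSp n))) z
      = r ^ 2 * (Δ φ) (r • (z : EucSp n))
        - r ^ 2 * fderiv ℝ (fderiv ℝ φ) (r • (z : EucSp n)) z z
        - n * r * fderiv ℝ φ (r • (z : EucSp n)) z := by
  set x : EucSp n := (z : EucSp n) with hx
  have hxn : ‖x‖ = 1 := norm_coe_sph z
  have hx0 : x ≠ 0 := coe_sph_ne_zero z
  set b := stdOrthonormalBasis ℝ (EucSp n) with hb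
  have hφ2 : ContDiff ℝ 2 φ := contDiff_infty.1 hφ 2
  have hφd : Differentiable ℝ φ := hφ2.differentiable two_ne_zero
  have hφd2 : Differentiable ℝ (fderiv ℝ φ) :=
    (hφ2.fderiv_right (m := 1) (by norm_num)).differentiable one_ne_zero
  -- The extension constant on rays, near `x`.
  have hext : homExt 0 (fun w : UnitSph n => φ (r • (w : EucSp n)))
      =ᶠ[𝓝 x] fun y => φ (r • (‖y‖⁻¹ • y)) := by
    filter_upwards [isOpen_ne.mem_nhds hx0] with y hy
    rw [homExt_of_ne _ _ hy, zpow_zero, one_mul, radialProj]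
  have hsm : ContDiffAt ℝ 2 (fun y : EucSp n => φ (r • (‖y‖⁻¹ • y))) x := by
    have h1 : ContDiffAt ℝ 2 (fun y : EucSp n => ‖y‖⁻¹) x :=
      (contDiffAt_norm ℝ hx0).inv (norm_ne_zero_iff.2 hx0)
    have h2 : ContDiffAt ℝ 2 (fun y : EucSp n => r • (‖y‖⁻¹ • y)) x :=
      (h1.smul contDiffAt_id).const_smul r
    exact hφ2.contDiffAt.comp x h2
  rw [sphLaplacian, laplacian_congr_nhds hext |>.eq_of_nhds]
  -- The function `t ↦ |x + t e|⁻¹` and its first two derivatives.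
  set P : EucSp n → ℝ → ℝ := fun e t => 1 + 2 * inner ℝ x e * t + t ^ 2 with hP
  have hPn : ∀ e : EucSp n, ‖e‖ = 1 → ∀ t : ℝ, ‖x + t • e‖ = √(P e t) := by
    intro e he t
    rw [hP, ← Real.sqrt_sq (norm_nonneg (x + t • e)), norm_add_sq_real, inner_smul_right, norm_smul,
      hxn, he, Real.norm_eq_abs, mul_one, sq_abs]
    congr 1
    ring
  have hPd : ∀ (e : EucSp n) (t : ℝ), HasDerivAt (P e) (2 * inner ℝ x e + 2 * t) t := by
    intro e t
    have := (((hasDerivAt_id t).const_mul (2 * inner ℝ x e)).const_add 1).add (hasDerivAt_pow 2 t)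
    refine this.congr_deriv ?_
    simp
  have hPpos : ∀ e : EucSp n, ∀ᶠ t in 𝓝 (0 : ℝ), 0 < P e t := by
    intro e
    have : Tendsto (P e) (𝓝 0) (𝓝 (P e 0)) := (hPd e 0).continuousAt.tendsto
    refine this.eventually_const_lt ?_
    simp [hP]
  set σ : EucSp n → ℝ → ℝ := fun e t => (√(P e t))⁻¹ with hσ
  set σ' : EucSp n → ℝ → ℝ := fun e t => -(inner ℝ x e + t) * ((√(P e t))⁻¹) ^ 3 with hσ'
  have hσd : ∀ (e : EucSp n) (t : ℝ), 0 < P e t → HasDerivAt (σ e) (σ' e t) t := by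
    intro e t ht
    have := ((hPd e t).sqrt ht.ne').fun_inv (Real.sqrt_pos.2 ht).ne'
    refine this.congr_deriv ?_
    have hs := Real.sqrt_pos.2 ht
    simp only [hσ']
    field_simp
  have hP0 : ∀ e, P e 0 = 1 := fun e => by simp [hP]
  have hσ0 : ∀ e, σ e 0 = 1 := fun e => by simp [hσ, hP0]
  have hσ'd : ∀ e : EucSp n, HasDerivAt (σ' e) (3 * inner ℝ x e ^ 2 - 1) 0 := by
    intro e
    have h1 := (hσd e 0 (by rw [hP0]; norm_num)).pow 3
    have h2 : HasDerivAt (fun t : ℝ => -(inner ℝ x e + t)) (-1) 0 :=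
      ((hasDerivAt_id (0 : ℝ)).const_add _).neg
    have := h2.mul h1
    refine this.congr_deriv ?_
    simp [hσ', hσ, hP0]
    ring
  -- The curve on the sphere of radius `r`.
  have hlin : ∀ (e : EucSp n) (t : ℝ), HasDerivAt (fun t : ℝ => x + t • e) e t := by
    intro e t
    simpa using ((hasDerivAt_id t).smul_const e).const_add x
  set γ : EucSp n → ℝ → EucSp n := fun e t => r • (σ e t • (x + t • e)) with hγ
  set γ' : EucSp n → ℝ → EucSp n := fun e t => r • (σ e t • e + σ' e t • (x + t • e)) with hγ'
  have hγd : ∀ (e : EucSp n) (t : ℝ), 0 < P e t → HasDerivAt (γ e) (γ' e t) t := by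
    intro e t ht
    exact ((hσd e t ht).smul (hlin e t)).const_smul r
  have hγ'd : ∀ e : EucSp n, HasDerivAt (γ' e)
      (r • ((-2 * inner ℝ x e) • e + (3 * inner ℝ x e ^ 2 - 1) • x)) 0 := by
    intro e
    have h1 := ((hσd e 0 (by rw [hP0]; norm_num)).smul_const e).add ((hσ'd e).smul (hlin e 0))
    refine (h1.const_smul r).congr_deriv ?_
    simp only [hσ', hP0, add_zero, Real.sqrt_one, inv_one, one_pow, mul_one, zero_smul]
    congr 1
    module
  have hγ0 : ∀ e, γ e 0 = r • x := fun e => by simp [hγ, hσ0]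
  have hγ'0 : ∀ e, γ' e 0 = r • (e - inner ℝ x e • x) := fun e => by
    simp [hγ', hσ0, hσ', hP0, sub_eq_add_neg]
  rw [laplacian_eq_sum_of_hasDerivAt b hsm
    (D := fun i t => fderiv ℝ φ (γ (b i) t) (γ' (b i) t))
    (c := fun i => fderiv ℝ (fderiv ℝ φ) (r • x) (r • (b i - inner ℝ x (b i) • x))
        (r • (b i - inner ℝ x (b i) • x))
      + fderiv ℝ φ (r • x) (r • ((-2 * inner ℝ x (b i)) • b i
        + (3 * inner ℝ x (b i) ^ 2 - 1) • x)))]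
  · have hlap : (Δ φ) (r • x) = ∑ i, fderiv ℝ (fderiv ℝ φ) (r • x) (b i) (b i) := by
      rw [laplacian_eq_iteratedFDeriv_orthonormalBasis φ b]
      refine Finset.sum_congr rfl fun i _ => ?_
      rw [iteratedFDeriv_two_apply]
      simp
    have hsum : ∑ i, inner ℝ x (b i) • b i = x := by
      have := b.sum_repr' x
      simpa only [real_inner_comm] using this
    have hsq : ∑ i, inner ℝ x (b i) ^ 2 = 1 := by
      have := b.sum_inner_mul_inner x x
      rw [real_inner_self_eq_norm_sq, hxn, one_pow] at this
      rw [← this]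
      refine Finset.sum_congr rfl fun i _ => ?_
      rw [real_inner_comm x (b i), sq]
    set T := fderiv ℝ (fderiv ℝ φ) (r • x) with hT
    set S := fderiv ℝ φ (r • x) with hS
    have e1 : ∑ i, inner ℝ x (b i) * T (b i) x = T x x := by
      calc _ = T (∑ i, inner ℝ x (b i) • b i) x := by
            simp only [map_sum, map_smul, _root_.sum_apply, _root_.smul_apply, smul_eq_mul]
        _ = _ := by rw [hsum]
    have e2 : ∑ i, inner ℝ x (b i) * T x (b i) = T x x := by
      conv_rhs => enter [2]; rw [← hsum]
      simp
    have e3 : ∑ i, inner ℝ x (b i) * S (b i) = S x := by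
      conv_rhs => rw [← hsum]
      simp
    have e4 : ∀ i, T (r • (b i - inner ℝ x (b i) • x)) (r • (b i - inner ℝ x (b i) • x))
        + S (r • ((-2 * inner ℝ x (b i)) • b i + (3 * inner ℝ x (b i) ^ 2 - 1) • x))
        = r ^ 2 * T (b i) (b i) - r ^ 2 * (inner ℝ x (b i) * T (b i) x)
          - r ^ 2 * (inner ℝ x (b i) * T x (b i)) + (r ^ 2 * T x x) * inner ℝ x (b i) ^ 2
          - (2 * r) * (inner ℝ x (b i) * S (b i)) + (3 * r * S x) * inner ℝ x (b i) ^ 2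
          - r * S x := by
      intro i
      simp only [map_smul, map_sub, map_add, _root_.smul_apply, _root_.sub_apply,
        smul_eq_mul]
      ring
    simp only [e4, Finset.sum_sub_distrib, Finset.sum_add_distrib, ← Finset.mul_sum, e1, e2, e3,
      hsq, ← hlap]
    simp
    ring
  · intro i
    filter_upwards [hPpos (b i), (hPpos (b i)).eventually_nhds] with t ht ht'
    have h1 := (hφd (γ (b i) t)).hasFDerivAt.comp_hasDerivAt t (hγd (b i) t ht)
    refine h1.congr_of_eventuallyEq (.of_forall fun s => ?_)
    simp only [Function.comp, hγ, hσ]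
    rw [hPn _ (b.norm_eq_one i)]
  · intro i
    have h1 := (hφd2 (γ (b i) 0)).hasFDerivAt.comp_hasDerivAt (0 : ℝ)
      (hγd (b i) 0 (by rw [hP0]; norm_num))
    have h2 := h1.clm_apply (hγ'd (b i))
    refine h2.congr_deriv ?_
    simp only [Function.comp, hγ0, hγ'0]

end Polar

/-! ### The equation on the sphere -/

section Sphere

variable {n : ℕ}

lemma integral_volumeIoiPow (m : ℕ) (g : ℝ → ℝ) :
    ∫ r : Ioi (0 : ℝ), g r ∂(Measure.volumeIoiPow m) = ∫ r in Ioi (0 : ℝ), r ^ m * g r := by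
  simp only [Measure.volumeIoiPow, ENNReal.ofReal]
  rw [integral_withDensity_eq_integral_smul, ← integral_subtype_comap measurableSet_Ioi
    (fun r : ℝ => r ^ m * g r)]
  · refine integral_congr_ae (.of_forall fun r => ?_)
    have hr : (0 : ℝ) < r := r.2
    simp only [NNReal.smul_def, smul_eq_mul]
    rw [Real.coe_toNNReal _ (by positivity)]
  · exact (measurable_subtype_coe.pow_const _).real_toNNReal

lemma integral_eq_integral_prod_sph (h : EucSp n → ℝ) :
    ∫ y, h y = ∫ p : UnitSph n × Ioi (0 : ℝ), h ((p.2 : ℝ) • (p.1 : EucSp n))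
      ∂((volume : Measure (EucSp n)).toSphere.prod (Measure.volumeIoiPow n)) := by
  have hmp := (volume : Measure (EucSp n)).measurePreserving_homeomorphUnitSphereProd
  rw [finrank_euclideanSpace_fin, Nat.add_sub_cancel] at hmp
  have h1 := hmp.integral_comp (Homeomorph.measurableEmbedding _)
    (fun p : UnitSph n × Ioi (0 : ℝ) => h ((p.2 : ℝ) • (p.1 : EucSp n)))
  have h2 := integral_subtype_comap (μ := (volume : Measure (EucSp n)))
    (measurableSet_singleton (0 : EucSp n)).compl h
  rw [restrict_compl_singleton] at h2
  rw [← h1, ← h2]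
  refine integral_congr_ae (.of_forall fun y => ?_)
  have hy : (y : EucSp n) ≠ 0 := y.2
  simp only [homeomorphUnitSphereProd_apply_snd_coe, homeomorphUnitSphereProd_apply_fst_coe]
  rw [smul_smul, mul_inv_cancel₀ (norm_ne_zero_iff.2 hy), one_smul]

lemma integrable_prod_sph {h : EucSp n → ℝ} (hh : Integrable h) :
    Integrable (fun p : UnitSph n × Ioi (0 : ℝ) => h ((p.2 : ℝ) • (p.1 : EucSp n)))
      ((volume : Measure (EucSp n)).toSphere.prod (Measure.volumeIoiPow n)) := by
  have hmp := (volume : Measure (EucSp n)).measurePreserving_homeomorphUnitSphereProd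
  rw [finrank_euclideanSpace_fin, Nat.add_sub_cancel] at hmp
  rw [← hmp.integrable_comp_emb (Homeomorph.measurableEmbedding _)]
  have h1 : IntegrableOn h ({0}ᶜ : Set (EucSp n)) := hh.integrableOn
  rw [integrableOn_iff_comap_subtypeVal (measurableSet_singleton _).compl] at h1
  refine h1.congr (.of_forall fun y => ?_)
  have hy : (y : EucSp n) ≠ 0 := y.2
  simp only [Function.comp, homeomorphUnitSphereProd_apply_snd_coe,
    homeomorphUnitSphereProd_apply_fst_coe]
  rw [smul_smul, mul_inv_cancel₀ (norm_ne_zero_iff.2 hy), one_smul]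

/-- Integration in polar coordinates, the radial integral being the inner one. -/
lemma integral_eq_integral_sph_integral_Ioi {h : EucSp n → ℝ} (hh : Integrable h) :
    ∫ y, h y = ∫ z : UnitSph n, ∫ r in Ioi (0 : ℝ), r ^ n * h (r • (z : EucSp n))
      ∂volume ∂(volume : Measure (EucSp n)).toSphere := by
  rw [integral_eq_integral_prod_sph, integral_prod _ (integrable_prod_sph hh)]
  refine integral_congr_ae (.of_forall fun z => ?_)
  exact integral_volumeIoiPow n fun r => h (r • (z : EucSp n))

/-- Integration in polar coordinates, the integral over the sphere being the inner one. -/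
lemma integral_eq_integral_Ioi_integral_sph {h : EucSp n → ℝ} (hh : Integrable h) :
    ∫ y, h y = ∫ r in Ioi (0 : ℝ), r ^ n * ∫ z : UnitSph n, h (r • (z : EucSp n))
      ∂(volume : Measure (EucSp n)).toSphere := by
  rw [integral_eq_integral_prod_sph, integral_prod_symm _ (integrable_prod_sph hh)]
  exact integral_volumeIoiPow n fun r => ∫ z : UnitSph n, h (r • (z : EucSp n))
      ∂(volume : Measure (EucSp n)).toSphere

lemma continuous_laplacian {φ : EucSp n → ℝ} (hφ : ContDiff ℝ ∞ φ) : Continuous (Δ φ) := by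
  have : (Δ φ) = fun x => ∑ i, fderiv ℝ (fderiv ℝ φ) x (stdOrthonormalBasis ℝ (EucSp n) i)
      (stdOrthonormalBasis ℝ (EucSp n) i) := by
    rw [laplacian_eq_iteratedFDeriv_stdOrthonormalBasis]
    ext x
    refine Finset.sum_congr rfl fun i _ => ?_
    rw [iteratedFDeriv_two_apply]
    simp
  rw [this]
  have h2 : Continuous (fderiv ℝ (fderiv ℝ φ)) :=
    ((contDiff_infty.1 hφ 2).fderiv_right (m := 1) (by norm_num)).continuous_fderiv one_ne_zero
  exact continuous_finsetSum _ fun i _ => (h2.clm_apply continuous_const).clm_apply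
    continuous_const

/-- The radial density of `∫ |y| u(y/|y|) Δφ(y) dy` after integration by parts along a ray. -/
def rayDensity (φ : EucSp n → ℝ) (z : UnitSph n) (r : ℝ) : ℝ :=
  r ^ (n + 1) * (Δ φ) (r • (z : EucSp n))
    - (r ^ (n + 1) * fderiv ℝ (fderiv ℝ φ) (r • (z : EucSp n)) z z
      + n * r ^ n * fderiv ℝ φ (r • (z : EucSp n)) z - n * r ^ (n - 1) * φ (r • (z : EucSp n)))

/-- The first two radial terms of the Laplacian cancel those of the ray density, and the spherical
Laplacian remains. -/
lemma rayDensity_eq (hn : 1 ≤ n) {φ : EucSp n → ℝ} (hφ : ContDiff ℝ ∞ φ) (z : UnitSph n) (r : ℝ) :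
    rayDensity φ z r = r ^ (n - 1) *
      (sphLaplacian (fun w : UnitSph n => φ (r • (w : EucSp n))) z
        + n * φ (r • (z : EucSp n))) := by
  rw [sphLaplacian_eq hφ, rayDensity]
  obtain ⟨m, rfl⟩ := Nat.exists_eq_add_of_le' hn
  rw [Nat.add_sub_cancel]
  ring

lemma continuous_rayDensity {φ : EucSp n → ℝ} (hφ : ContDiff ℝ ∞ φ) :
    Continuous fun p : UnitSph n × ℝ => rayDensity φ p.1 p.2 := by
  have hp : Continuous fun p : UnitSph n × ℝ => p.2 • (p.1 : EucSp n) := by fun_prop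
  have hp1 : Continuous fun p : UnitSph n × ℝ => (p.1 : EucSp n) := by fun_prop
  have h1 : Continuous fun p : UnitSph n × ℝ => (Δ φ) (p.2 • (p.1 : EucSp n)) :=
    (continuous_laplacian hφ).comp hp
  have h2 : Continuous fun p : UnitSph n × ℝ => fderiv ℝ φ (p.2 • (p.1 : EucSp n)) p.1 :=
    ((hφ.continuous_fderiv (by simp)).comp hp).clm_apply hp1
  have h3 : Continuous fun p : UnitSph n × ℝ =>
      fderiv ℝ (fderiv ℝ φ) (p.2 • (p.1 : EucSp n)) p.1 p.1 :=
    (((((contDiff_infty.1 hφ 2).fderiv_right (m := 1) (by norm_num)).continuous_fderiv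
      one_ne_zero).comp hp).clm_apply hp1).clm_apply hp1
  have h4 : Continuous fun p : UnitSph n × ℝ => φ (p.2 • (p.1 : EucSp n)) :=
    hφ.continuous.comp hp
  unfold rayDensity
  fun_prop

/-- Outside of a large ball, a test function and its derivatives vanish along all rays. -/
lemma exists_forall_ray_eq_zero {φ : EucSp n → ℝ} (hφs : HasCompactSupport φ) :
    ∃ R : ℝ, 0 < R ∧ ∀ (z : UnitSph n) (r : ℝ), R < |r| → φ (r • (z : EucSp n)) = 0 ∧
      fderiv ℝ φ (r • (z : EucSp n)) = 0 ∧ fderiv ℝ (fderiv ℝ φ) (r • (z : EucSp n)) = 0 ∧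
      (Δ φ) (r • (z : EucSp n)) = 0 := by
  obtain ⟨R, hR0, hR⟩ := hφs.isCompact.isBounded.subset_closedBall_lt 0 (0 : EucSp n)
  refine ⟨R, hR0, fun z r hr => ?_⟩
  have hnot : r • (z : EucSp n) ∉ tsupport φ := by
    intro hmem
    have := mem_closedBall_zero_iff.1 (hR hmem)
    rw [norm_smul, norm_coe_sph, mul_one, Real.norm_eq_abs] at this
    linarith
  have hev : φ =ᶠ[𝓝 (r • (z : EucSp n))] fun _ => 0 := by
    rw [notMem_tsupport_iff_eventuallyEq] at hnot
    exact hnot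
  refine ⟨hev.eq_of_nhds, ?_, ?_, ?_⟩
  · rw [hev.fderiv_eq]; simp
  · rw [hev.fderiv.fderiv_eq]; simp
  · rw [(laplacian_congr_nhds hev).eq_of_nhds]; simp

lemma hasDerivAt_comp_ray {h : EucSp n → ℝ} (hh : Differentiable ℝ h) (v : EucSp n) (r : ℝ) :
    HasDerivAt (fun r : ℝ => h (r • v)) (fderiv ℝ h (r • v) v) r := by
  have hline : HasDerivAt (fun r : ℝ => r • v) v r := by
    simpa using (hasDerivAt_id r).smul_const v
  exact (hh (r • v)).hasFDerivAt.comp_hasDerivAt r hline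

lemma hasDerivAt_fderiv_ray {φ : EucSp n → ℝ} (hφ : ContDiff ℝ ∞ φ) (v : EucSp n) (r : ℝ) :
    HasDerivAt (fun r : ℝ => fderiv ℝ φ (r • v) v) (fderiv ℝ (fderiv ℝ φ) (r • v) v v) r := by
  have hd : Differentiable ℝ (fderiv ℝ φ) :=
    ((contDiff_infty.1 hφ 2).fderiv_right (m := 1) (by norm_num)).differentiable one_ne_zero
  have h := hasDerivAt_comp_ray (h := fun y => fderiv ℝ φ y v)
    (hd.clm_apply (differentiable_const v)) v r
  refine h.congr_deriv ?_
  rw [((hd (r • v)).hasFDerivAt.clm_apply (hasFDerivAt_const v (r • v))).fderiv]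
  simp

lemma integral_Ioi_rayDensity (hn : 1 ≤ n) {φ : EucSp n → ℝ} (hφ : ContDiff ℝ ∞ φ)
    (hφs : HasCompactSupport φ) (z : UnitSph n) :
    ∫ r in Ioi (0 : ℝ), rayDensity φ z r
      = ∫ r in Ioi (0 : ℝ), r ^ (n + 1) * (Δ φ) (r • (z : EucSp n)) := by
  obtain ⟨R, hR0, hR⟩ := exists_forall_ray_eq_zero hφs
  have hcs : ∀ g : ℝ → ℝ, (∀ r, R < |r| → g r = 0) → HasCompactSupport g := by
    intro g hg
    refine HasCompactSupport.of_support_subset_isCompact (isCompact_closedBall (0 : ℝ) R) ?_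
    intro r hr
    rw [mem_closedBall_zero_iff, Real.norm_eq_abs]
    by_contra hcon
    exact hr (hg r (not_le.1 hcon))
  have hp : Continuous fun r : ℝ => r • (z : EucSp n) := by fun_prop
  have c1 : Continuous fun r : ℝ => (Δ φ) (r • (z : EucSp n)) := (continuous_laplacian hφ).comp hp
  have c2 : Continuous fun r : ℝ => fderiv ℝ φ (r • (z : EucSp n)) z :=
    ((hφ.continuous_fderiv (by simp)).comp hp).clm_apply continuous_const
  have c3 : Continuous fun r : ℝ => fderiv ℝ (fderiv ℝ φ) (r • (z : EucSp n)) z z :=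
    (((((contDiff_infty.1 hφ 2).fderiv_right (m := 1) (by norm_num)).continuous_fderiv
      one_ne_zero).comp hp).clm_apply continuous_const).clm_apply continuous_const
  have c4 : Continuous fun r : ℝ => φ (r • (z : EucSp n)) := hφ.continuous.comp hp
  set D : ℝ → ℝ := fun r => r ^ (n + 1) * fderiv ℝ (fderiv ℝ φ) (r • (z : EucSp n)) z z
      + n * r ^ n * fderiv ℝ φ (r • (z : EucSp n)) z - n * r ^ (n - 1) * φ (r • (z : EucSp n))
    with hD
  have hDint : Integrable D := by
    refine Continuous.integrable_of_hasCompactSupport (by fun_prop) (hcs D fun r hr => ?_)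
    obtain ⟨h1, h2, h3, -⟩ := hR z r hr
    simp [hD, h1, h2, h3]
  have hLint : Integrable fun r : ℝ => r ^ (n + 1) * (Δ φ) (r • (z : EucSp n)) := by
    refine Continuous.integrable_of_hasCompactSupport (by fun_prop) (hcs _ fun r hr => ?_)
    simp [(hR z r hr).2.2.2]
  have hder : ∀ r : ℝ, HasDerivAt (fun r : ℝ => r ^ (n + 1) * fderiv ℝ φ (r • (z : EucSp n)) z
      - r ^ n * φ (r • (z : EucSp n))) (D r) r := by
    intro r
    have h1 := hasDerivAt_comp_ray (hφ.differentiable (by simp)) (z : EucSp n) r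
    have h2 := hasDerivAt_fderiv_ray hφ (z : EucSp n) r
    have := ((hasDerivAt_pow (n + 1) r).mul h2).sub ((hasDerivAt_pow n r).mul h1)
    refine this.congr_deriv ?_
    simp [hD]
    ring
  have hzero : ∫ r in Ioi (0 : ℝ), D r = 0 := by
    have htend : Tendsto (fun r : ℝ => r ^ (n + 1) * fderiv ℝ φ (r • (z : EucSp n)) z
        - r ^ n * φ (r • (z : EucSp n))) atTop (𝓝 0) := by
      refine tendsto_const_nhds.congr' ?_
      filter_upwards [eventually_gt_atTop R] with r hr
      obtain ⟨h1, h2, -, -⟩ := hR z r (by rwa [abs_of_pos (hR0.trans hr)])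
      simp [h1, h2]
    rw [integral_Ioi_of_hasDerivAt_of_tendsto' (fun r _ => hder r) hDint.integrableOn htend]
    have : n ≠ 0 := by lia
    simp [this]
  have : ∀ r, rayDensity φ z r = r ^ (n + 1) * (Δ φ) (r • (z : EucSp n)) - D r := fun r => rfl
  simp only [this]
  rw [integral_sub hLint.integrableOn hDint.integrableOn, hzero, sub_zero]

/-- Testing the `1`-homogeneous extension of `u` with `Δ φ` amounts to testing `u` on the sphere
with the functions `z ↦ φ(r z)`, `r > 0`. -/
lemma integral_homExt_one_mul_laplacian (hn : 1 ≤ n) {u : UnitSph n → ℝ} (hu : Continuous u)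
    {φ : EucSp n → ℝ} (hφ : ContDiff ℝ ∞ φ) (hφs : HasCompactSupport φ) :
    ∫ y, homExt 1 u y * (Δ φ) y = ∫ r in Ioi (0 : ℝ), r ^ (n - 1) * ∫ z : UnitSph n,
      u z * (sphLaplacian (fun w : UnitSph n => φ (r • (w : EucSp n))) z
        + n * φ (r • (z : EucSp n))) ∂(volume : Measure (EucSp n)).toSphere := by
  obtain ⟨R, hR0, hR⟩ := exists_forall_ray_eq_zero hφs
  have hΔs : HasCompactSupport (Δ φ) := by
    refine hφs.mono' fun y hy => ?_
    by_contra hnot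
    rw [notMem_tsupport_iff_eventuallyEq] at hnot
    have hnot : φ =ᶠ[𝓝 y] fun _ => 0 := hnot
    apply hy
    rw [(laplacian_congr_nhds hnot).eq_of_nhds]; simp
  have hint : Integrable fun y => homExt 1 u y * (Δ φ) y :=
    LocallyIntegrable.integrable_mul_of_hasCompactSupport
      (continuous_homExt_one hu).locallyIntegrable (continuous_laplacian hφ) hΔs
  have hJint : Integrable (fun p : UnitSph n × ℝ => u p.1 * rayDensity φ p.1 p.2)
      ((volume : Measure (EucSp n)).toSphere.prod (volume.restrict (Ioi 0))) := by
    have h1 : Integrable (fun p : UnitSph n × ℝ => u p.1 * rayDensity φ p.1 p.2)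
        ((volume : Measure (EucSp n)).toSphere.prod volume) := by
      refine Continuous.integrable_of_hasCompactSupport
        ((hu.comp continuous_fst).mul (continuous_rayDensity hφ)) ?_
      refine HasCompactSupport.of_support_subset_isCompact
        (isCompact_univ.prod (isCompact_closedBall (0 : ℝ) R)) ?_
      intro p hp
      refine ⟨mem_univ _, ?_⟩
      rw [mem_closedBall_zero_iff, Real.norm_eq_abs]
      by_contra hcon
      apply hp
      obtain ⟨h1, h2, h3, h4⟩ := hR p.1 p.2 (not_le.1 hcon)
      simp [rayDensity, h1, h2, h3, h4]
    have h2 := h1.integrableOn (s := univ ×ˢ Ioi 0)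
    rwa [IntegrableOn, ← Measure.prod_restrict, Measure.restrict_univ] at h2
  rw [integral_eq_integral_sph_integral_Ioi hint]
  have e1 : ∀ z : UnitSph n,
      ∫ r in Ioi (0 : ℝ), r ^ n * (homExt 1 u (r • (z : EucSp n)) * (Δ φ) (r • (z : EucSp n)))
      = ∫ r in Ioi (0 : ℝ), u z * rayDensity φ z r := by
    intro z
    rw [integral_const_mul, integral_Ioi_rayDensity hn hφ hφs z, ← integral_const_mul]
    refine setIntegral_congr_fun measurableSet_Ioi fun r hr => ?_
    rw [homExt_smul 1 u hr, homExt_coe, zpow_one]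
    ring
  simp only [e1]
  rw [integral_integral_swap hJint]
  refine setIntegral_congr_fun measurableSet_Ioi fun r _ => ?_
  rw [← integral_const_mul]
  refine integral_congr_ae (.of_forall fun z => ?_)
  simp only
  rw [rayDensity_eq hn hφ]
  ring

lemma integral_homExt_neg_one_mul (hn : 1 ≤ n) {f : UnitSph n → ℝ}
    (hf : LocallyIntegrable (homExt (-1) f) (volume : Measure (EucSp n)))
    {φ : EucSp n → ℝ} (hφ : Continuous φ) (hφs : HasCompactSupport φ) :
    ∫ y, homExt (-1) f y * φ y = ∫ r in Ioi (0 : ℝ), r ^ (n - 1) * ∫ z : UnitSph n,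
      f z * φ (r • (z : EucSp n)) ∂(volume : Measure (EucSp n)).toSphere := by
  rw [integral_eq_integral_Ioi_integral_sph
    (LocallyIntegrable.integrable_mul_of_hasCompactSupport hf hφ hφs)]
  refine setIntegral_congr_fun measurableSet_Ioi fun r hr => ?_
  have hr : 0 < r := hr
  rw [← integral_const_mul, ← integral_const_mul]
  refine integral_congr_ae (.of_forall fun z => ?_)
  simp only
  rw [homExt_smul _ f hr, homExt_coe, zpow_neg_one]
  obtain ⟨m, rfl⟩ := Nat.exists_eq_add_of_le' hn
  rw [Nat.add_sub_cancel, pow_succ]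
  field_simp

lemma contDiffAt_comp_radial {ψ : EucSp n → ℝ} (hψ : ContDiff ℝ ∞ ψ) {y : EucSp n} (hy : y ≠ 0) :
    ContDiffAt ℝ ∞ (fun y : EucSp n => ψ (‖y‖⁻¹ • y)) y := by
  have h1 : ContDiffAt ℝ ∞ (fun y : EucSp n => ‖y‖⁻¹) y :=
    (contDiffAt_norm ℝ hy).inv (norm_ne_zero_iff.2 hy)
  exact hψ.contDiffAt.comp y (h1.smul contDiffAt_id)

lemma sphLaplacian_const_mul {ψ : EucSp n → ℝ} (hψ : ContDiff ℝ ∞ ψ) (a : ℝ) (z : UnitSph n) :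
    sphLaplacian (fun w : UnitSph n => a * ψ w) z
      = a * sphLaplacian (fun w : UnitSph n => ψ w) z := by
  have hext : homExt 0 (fun w : UnitSph n => ψ w)
      =ᶠ[𝓝 (z : EucSp n)] fun y => ψ (‖y‖⁻¹ • y) := by
    filter_upwards [isOpen_ne.mem_nhds (coe_sph_ne_zero z)] with y hy
    rw [homExt_of_ne _ _ hy, zpow_zero, one_mul, radialProj]
  have hsm : ContDiffAt ℝ 2 (homExt 0 (fun w : UnitSph n => ψ w)) (z : EucSp n) :=
    (contDiffAt_infty.1 (contDiffAt_comp_radial hψ (coe_sph_ne_zero z)) 2).congr_of_eventuallyEq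
      hext
  have e : homExt 0 (fun w : UnitSph n => a * ψ w) = a • homExt 0 (fun w : UnitSph n => ψ w) := by
    ext y
    by_cases hy : y = 0
    · simp [hy, homExt_zero]
    · simp [homExt_of_ne _ _ hy]
  rw [sphLaplacian, e, laplacian_smul a hsm, smul_eq_mul, sphLaplacian]

/-- The equation for the homogeneous extensions is equivalent to the equation on the sphere. -/
lemma solvesLaplace_iff_solvesSphere (hn : 1 ≤ n) {f u : UnitSph n → ℝ} (hu : Continuous u)
    (hf : LocallyIntegrable (homExt (-1) f) (volume : Measure (EucSp n))) :
    SolvesLaplace (homExt (-1) f) (homExt 1 u) ↔ SolvesSphere f u := by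
  constructor
  · intro hsol ψ hψ
    -- Test with the product of a radial cutoff and the extension of `ψ` constant on rays.
    set η : ContDiffBump (2 : ℝ) := ⟨1 / 2, 1, by norm_num, by norm_num⟩ with hη
    have hη0 : ∀ r : ℝ, r ≤ 1 → η r = 0 := fun r hr => η.zero_of_le_dist (by
      rw [Real.dist_eq, abs_sub_comm, abs_of_nonneg (by linarith)]; simp [hη]; linarith)
    have hη3 : ∀ r : ℝ, 3 ≤ r → η r = 0 := fun r hr => η.zero_of_le_dist (by
      rw [Real.dist_eq, abs_of_nonneg (by linarith)]; simp [hη]; linarith)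
    set φ : EucSp n → ℝ := fun y => η ‖y‖ * ψ (‖y‖⁻¹ • y) with hφdef
    have hφ : ContDiff ℝ ∞ φ := by
      rw [contDiff_iff_contDiffAt]
      intro y
      by_cases hy : y = 0
      · have : φ =ᶠ[𝓝 y] fun _ => 0 := by
          rw [hy]
          filter_upwards [ball_mem_nhds (0 : EucSp n) zero_lt_one] with w hw
          rw [hφdef]
          simp [hη0 ‖w‖ (mem_ball_zero_iff.1 hw).le]
        exact contDiffAt_const.congr_of_eventuallyEq this
      · exact (η.contDiffAt.comp y (contDiffAt_norm ℝ hy)).mul (contDiffAt_comp_radial hψ hy)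
    have hφs : HasCompactSupport φ := by
      refine HasCompactSupport.of_support_subset_isCompact
        (isCompact_closedBall (0 : EucSp n) 3) fun y hy => ?_
      rw [mem_closedBall_zero_iff]
      by_contra hcon
      apply hy
      rw [hφdef]
      simp [hη3 ‖y‖ (not_le.1 hcon).le]
    have hray : ∀ r : ℝ, 0 < r → ∀ z : UnitSph n, φ (r • (z : EucSp n)) = η r * ψ z := by
      intro r hr z
      simp only [hφdef]
      rw [norm_smul, norm_coe_sph, mul_one, Real.norm_of_nonneg hr.le, smul_smul,
        inv_mul_cancel₀ hr.ne', one_smul]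
    have h := hsol φ hφ hφs
    rw [integral_homExt_one_mul_laplacian hn hu hφ hφs,
      integral_homExt_neg_one_mul hn hf hφ.continuous hφs] at h
    have e1 : ∫ r in Ioi (0 : ℝ), r ^ (n - 1) * ∫ z : UnitSph n,
        u z * (sphLaplacian (fun w : UnitSph n => φ (r • (w : EucSp n))) z
          + n * φ (r • (z : EucSp n))) ∂(volume : Measure (EucSp n)).toSphere
        = (∫ r in Ioi (0 : ℝ), r ^ (n - 1) * η r) * ∫ z : UnitSph n,
          u z * (sphLaplacian (fun w : UnitSph n => ψ w) z + n * ψ z)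
            ∂(volume : Measure (EucSp n)).toSphere := by
      rw [← integral_mul_const]
      refine setIntegral_congr_fun measurableSet_Ioi fun r hr => ?_
      have hr : 0 < r := hr
      simp only [hray r hr, sphLaplacian_const_mul hψ]
      rw [mul_assoc, ← integral_const_mul, ← integral_const_mul, ← integral_const_mul]
      refine integral_congr_ae (.of_forall fun z => ?_)
      ring
    have e2 : ∫ r in Ioi (0 : ℝ), r ^ (n - 1) * ∫ z : UnitSph n,
        f z * φ (r • (z : EucSp n)) ∂(volume : Measure (EucSp n)).toSphere
        = (∫ r in Ioi (0 : ℝ), r ^ (n - 1) * η r) * ∫ z : UnitSph n, f z * ψ z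
            ∂(volume : Measure (EucSp n)).toSphere := by
      rw [← integral_mul_const]
      refine setIntegral_congr_fun measurableSet_Ioi fun r hr => ?_
      have hr : 0 < r := hr
      simp only [hray r hr]
      rw [mul_assoc, ← integral_const_mul, ← integral_const_mul, ← integral_const_mul]
      refine integral_congr_ae (.of_forall fun z => ?_)
      ring
    rw [e1, e2] at h
    refine mul_left_cancel₀ ?_ h
    rw [setIntegral_eq_integral_of_forall_compl_eq_zero fun r hr => by
      rw [hη0 r ((not_lt.1 hr).trans zero_le_one), mul_zero]]
    have hc : Continuous fun r : ℝ => r ^ (n - 1) * η r := (continuous_pow _).mul η.continuous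
    have hs : HasCompactSupport fun r : ℝ => r ^ (n - 1) * η r := η.hasCompactSupport.mul_left
    refine (hc.integral_pos_of_hasCompactSupport_nonneg_nonzero (x := 2) hs (fun r => ?_) ?_).ne'
    · change 0 ≤ r ^ (n - 1) * η r
      rcases le_total r 1 with hr | hr
      · rw [hη0 r hr, mul_zero]
      · exact mul_nonneg (by positivity) η.nonneg
    · rw [η.one_of_mem_closedBall (mem_closedBall_self (by norm_num))]
      positivity
  · intro hsol φ hφ hφs
    rw [integral_homExt_one_mul_laplacian hn hu hφ hφs,
      integral_homExt_neg_one_mul hn hf hφ.continuous hφs]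
    congr 1
    ext r
    congr 1
    exact hsol (fun y => φ (r • y)) (hφ.comp (contDiff_const_smul r))

end Sphere

/-! ### The integrand of the criterion -/

/-- For `ξ` orthogonal to `x`, the factor `-⟨ξ, y⟩` is `⟨x - y, ξ⟩`: the integrand is the derivative
of `F` times the gradient of the fundamental solution, up to a constant factor. -/
lemma critIntegrand_eq {n : ℕ} (F : EucSp n → ℝ) {x ξ : EucSp n} (hξx : inner ℝ ξ x = 0)
    (y : EucSp n) : critIntegrand F x ξ y = fderiv ℝ F y ξ *
      (inner ℝ (x - y) ξ * (‖x - y‖ ^ Module.finrank ℝ (EucSp n))⁻¹) := by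
  rw [critIntegrand, finrank_euclideanSpace_fin, inner_sub_left,
    real_inner_comm ξ x, hξx, real_inner_comm ξ y]
  ring

end

theorem theorem1p1 (n : ℕ) (hn : 2 ≤ n)
    (f : UnitSph n → ℝ) (hpos : ∀ z, 0 < f z) (hLip : ∃ K : NNReal, LipschitzWith K f)
    (u : UnitSph n → ℝ) (hu : Continuous u) :
    (SolvesLaplace (homExt (-1) f) (homExt 1 u) ↔ SolvesSphere f u) ∧
    (∀ x ξ : EucSp n, ‖x‖ = 1 → ‖ξ‖ = 1 → inner ℝ ξ x = 0 →
      Integrable (critIntegrand (homExt (-1) f) x ξ)) ∧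
    (SolvesLaplace (homExt (-1) f) (homExt 1 u) →
      (ConvexOn ℝ Set.univ (homExt 1 u) ↔
        ∀ x ξ : EucSp n, ‖x‖ = 1 → ‖ξ‖ = 1 → inner ℝ ξ x = 0 →
          0 ≤ ∫ y, critIntegrand (homExt (-1) f) x ξ y)) := by
  obtain ⟨G, L, c, hc, hG, hlow, hF⟩ := exists_lipschitz_inv_homExt hpos hLip
  have hd : 3 ≤ Module.finrank ℝ (EucSp n) := by
    rw [finrank_euclideanSpace_fin]; lia
  have hne : ∀ x : EucSp n, ‖x‖ = 1 → x ≠ 0 := fun x hx h => by simp [h] at hx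
  have hhomG : ∀ l : ℝ, 0 < l → ∀ y, G (l • y) = l * G y := by
    intro l hl y
    have h := homExt_smul (-1) f hl y
    rw [hF, zpow_neg_one, ← mul_inv] at h
    exact inv_injective h
  have hsing : ∀ x ξ : EucSp n, inner ℝ ξ x = 0 →
      ∫ y, critIntegrand (homExt (-1) f) x ξ y = singularHess G x ξ := by
    intro x ξ hξx
    simp only [critIntegrand_eq _ hξx, singularHess, hF]
  refine ⟨solvesLaplace_iff_solvesSphere (by lia) hu ?_, fun x ξ hx _ hξx => ?_, fun hsol => ?_⟩
  · rw [hF]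
    exact locallyIntegrable_inv hG hc hlow hd
  · rw [show critIntegrand (homExt (-1) f) x ξ = _ from
      funext fun y => critIntegrand_eq (homExt (-1) f) hξx y, hF]
    refine integrable_fderiv_inv_mul hG hc hlow hd (hne x hx) ξ
      (q := fun y => (‖x - y‖ ^ Module.finrank ℝ (EucSp n))⁻¹) ?_ fun y => ?_
    · exact ((continuous_const.sub continuous_id).norm.pow _).measurable.inv
    · rw [abs_of_nonneg (by positivity)]
  · obtain ⟨B, hB⟩ := (isCompact_univ (X := UnitSph n)).exists_bound_of_continuousOn
      hu.continuousOn
    have hB' : ∀ y, |homExt 1 u y| ≤ |B| * ‖y‖ :=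
      abs_homExt_one_le fun z => (hB z (Set.mem_univ z)).trans (le_abs_self B)
    have hhomU : ∀ l : ℝ, 0 < l → ∀ y : EucSp n, homExt 1 u (l • y) = l * homExt 1 u y :=
      fun l hl y => by rw [homExt_smul 1 u hl, zpow_one]
    rw [hF] at hsol
    rw [convexOn_iff_singularHess_nonneg hG hc hlow hd (continuous_homExt_one hu) (abs_nonneg B)
      hB' hhomU hsol]
    constructor
    · intro h x ξ hx _ hξx
      rw [hsing x ξ hξx]
      exact h x ξ (hne x hx) hξx
    · intro h x ξ hx hξx
      refine singularHess_nonneg_of_unit hhomG (fun x ξ hx hξ hξx => ?_) hx hξx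
      rw [← hsing x ξ hξx]
      exact h x ξ hx hξ hξx
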